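/- **Conventions.** Let $Q=\{(x,t)\in\mathbb R^2: x>0,\ t>0\}$. A $C^\infty$ function $f:(0,\infty)\to\mathbb C$ belongs to $C^\infty([0,\infty))$ if $\lim_{x\to0^+}f^{(N)}(x)$ exists in $\mathbb C$ for every integer $N\ge 0$. It belongs to $\mathcal S([0,\infty))$ if, in addition, $\sup_{x>0}|x^M f^{(N)}(x)|<\infty$ for all integers $M,N\ge 0$. Let $\Gamma$ be the positively oriented boundary of the sector $\{\lambda\in\mathbb C:\operatorname{Im}\lambda\ge0,\ \operatorname{Re}(\lambda^2)\le0\}$, i.e. the contour coming from $\infty e^{3i\pi/4}$ along a ray to $0$ and going from $0$ along a ray to $\infty e^{i\pi/4}$. **Theorem 1.1.** Let $u_0\in\mathcal S([0,\infty))$ and $g_0\in C^\infty([0,\infty))$ be complex-valued. Put $$\hat u_0(\lambda)=\int_0^\infty u_0(x)e^{-i\lambda x}\,dx\quad(\operatorname{Im}\lambda\le0),\qquad \tilde g_0(\lambda,t)=\int_0^t e^{\lambda^2\tau}g_0(\tau)\,d\tau\quad(\lambda\in\mathbb C,\ t>0),$$ and, for $(x,t)\in Q$, $$u(x,t)=\frac1{2\pi}\int_{-\infty}^{\infty}e^{i\lambda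 x-\lambda^2t}\hat u_0(\lambda)\,d\lambda-\frac1{2\pi}\int_{\Gamma}e^{i\lambda x-\lambda^2t}\hat u_0(-\lambda)\,d\lambda-\frac{i}{\pi}\int_{\Gamma}e^{i\lambda x-\lambda^2t}\lambda\,\tilde g_0(\lambda,t)\,d\lambda. \tag{1.1}$$ Then all these integrals converge absolutely, $u$ is $C^\infty$ on $Q$, and: 1. $u_t=u_{xx}$ on $Q$. 2. $\lim_{t\to0^+}u(x,t)=u_0(x)$ for each fixed $x>0$, and $\lim_{x\to0^+}u(x,t)=g_0(t)$ for each fixed $t>0$. 3. For each fixed $t>0$ the function $x\mapsto u(x,t)$ belongs to $C^\infty([0,\infty))$, and for every integer $n\ge0$ the function $g_n(t)=\lim_{x\to0^+}\partial_x^n u(x,t)$ is $C^\infty$ on $(0,\infty)$. 4. For each fixed $x>0$ the function $t\mapsto u(x,t)$ belongs to $C^\infty([0,\infty))$, and for every integer $n\ge0$ the function $u_n(x)=\lim_{t\to0^+}\partial_t^n u(x,t)$ is $C^\infty$ on $(0,\infty)$. 5. $u$ is rapidly decreasing as $x\to+\infty$, uniformly for $t$ in compact subsets of $(0,\infty)$: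 for all $0<\alpha<\beta$ and all integers $M,N\ge0$, $$\sup_{x>0,\ \alpha\le t\le\beta}\left|x^M\,\partial_x^N u(x,t)\right|<\infty .$$ -/

import Mathlib

open Set Filter Topology MeasureTheory
open scoped ContDiff

/-- The space `C^∞([0,∞))`: functions that are `C^∞` on `(0,∞)` and all of whose derivatives
(of order `N ≥ 0`) have a limit as `x → 0⁺`. Only the values on `(0,∞)` matter. -/
def SmoothHalfLine (f : ℝ → ℂ) : Prop :=
  ContDiffOn ℝ ∞ f (Ioi 0) ∧
    ∀ N : ℕ, ∃ L : ℂ, Tendsto (iteratedDeriv N f) (𝓝[>] 0) (𝓝 L)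

/-- The space `𝓢([0,∞))`: functions in `C^∞([0,∞))` such that `x ^ M * f^(N)(x)` is bounded
for all nonnegative integers `M`, `N`. -/
def SchwartzHalfLine (f : ℝ → ℂ) : Prop :=
  SmoothHalfLine f ∧
    ∀ M N : ℕ, ∃ C : ℝ, ∀ x : ℝ, 0 < x → ‖(x : ℂ) ^ M * iteratedDeriv N f x‖ ≤ C

/-- The open quadrant `Q = {(x,t) : x > 0, t > 0}`. -/
def openQuadrant : Set (ℝ × ℝ) := {p | 0 < p.1 ∧ 0 < p.2}

/-- A function `F = F(x,t)` on the open quadrant is rapidly decreasing as `x → +∞`, uniformly for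
`t` in compact subsets of `(0,∞)`. -/
def RapidlyDecreasingLocUnif (F : ℝ → ℝ → ℂ) : Prop :=
  ∀ α β : ℝ, 0 < α → α < β → ∀ M N : ℕ, ∃ C : ℝ, ∀ x : ℝ, 0 < x → ∀ t ∈ Icc α β,
    ‖(x : ℂ) ^ M * iteratedDeriv N (fun y => F y t) x‖ ≤ C

/-- The half-line Fourier transform `∫₀^∞ f(x) e^{-ikx} dx`, used for `Im k ≤ 0`. -/
noncomputable def halfLineFourier (f : ℝ → ℂ) (k : ℂ) : ℂ :=
  ∫ x in Ioi (0 : ℝ), f x * Complex.exp (-(Complex.I * k * x))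

/-- The transform `∫₀^t e^{k²τ} g(τ) dτ`. -/
noncomputable def timeTransform (g : ℝ → ℂ) (k : ℂ) (t : ℝ) : ℂ :=
  ∫ τ in (0 : ℝ)..t, Complex.exp (k ^ 2 * τ) * g τ

/-- The unit direction `e^{iπ/4}` of the right ray of the contour `Γ`. -/
noncomputable def rightDir : ℂ := Complex.exp ((Real.pi / 4 : ℝ) * Complex.I)

/-- The unit direction `e^{3iπ/4}` of the left ray of the contour `Γ`. -/
noncomputable def leftDir : ℂ := Complex.exp ((3 * Real.pi / 4 : ℝ) * Complex.I)

/-- The integral `∫_Γ F(k) dk` over the positively oriented boundary `Γ` of the sector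
`{k : Im k ≥ 0, Re (k²) ≤ 0} = {k : π/4 ≤ arg k ≤ 3π/4} ∪ {0}`: the contour comes in from
`∞ e^{3iπ/4}` to `0` along the left ray and goes out from `0` to `∞ e^{iπ/4}` along the right
ray, so that the sector lies to its left. -/
noncomputable def contourIntegral (F : ℂ → ℂ) : ℂ :=
  (∫ r in Ioi (0 : ℝ), F (r * rightDir) * rightDir) -
    ∫ r in Ioi (0 : ℝ), F (r * leftDir) * leftDir

/-- Absolute convergence of `∫_Γ F(k) dk`. -/
def ContourIntegrable (F : ℂ → ℂ) : Prop :=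
  IntegrableOn (fun r : ℝ => F (r * rightDir)) (Ioi 0) ∧
    IntegrableOn (fun r : ℝ => F (r * leftDir)) (Ioi 0)

/-- The integrand `e^{ikx - k²t} û₀(k)` of the integral over the real line. -/
noncomputable def lineIntegrand (u₀ : ℝ → ℂ) (x t : ℝ) (k : ℂ) : ℂ :=
  Complex.exp (Complex.I * k * x - k ^ 2 * t) * halfLineFourier u₀ k

/-- The integrand `e^{ikx - k²t} û₀(-k)` of the first integral over `Γ`. -/
noncomputable def initialIntegrand (u₀ : ℝ → ℂ) (x t : ℝ) (k : ℂ) : ℂ :=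
  Complex.exp (Complex.I * k * x - k ^ 2 * t) * halfLineFourier u₀ (-k)

/-- The integrand `e^{ikx - k²t} k g̃₀(k,t)` of the second integral over `Γ`. -/
noncomputable def boundaryIntegrand (g₀ : ℝ → ℂ) (x t : ℝ) (k : ℂ) : ℂ :=
  Complex.exp (Complex.I * k * x - k ^ 2 * t) * (k * timeTransform g₀ k t)

/-- The function `u(x,t)` given for `x > 0`, `t > 0` by the Fokas contour-integral formula. -/
noncomputable def fokas (u₀ g₀ : ℝ → ℂ) (x t : ℝ) : ℂ :=
  1 / (2 * Real.pi) * (∫ k : ℝ, lineIntegrand u₀ x t k)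
    - 1 / (2 * Real.pi) * contourIntegral (initialIntegrand u₀ x t)
    - Complex.I / Real.pi * contourIntegral (boundaryIntegrand g₀ x t)

/-!
The contour formula is the classical solution by the method of images in disguise, and everything
is read off from the latter.

*Passage to physical space.* On the rays of `Γ` the integrands decay like `e^{-rx/√2}`, so by
Fubini's theorem every integral in the formula is a superposition of integrals of `e^{ikx - k²s}`
and `k e^{ikx - k²s}`. Rotating the rays to the real axis (`integral_exp_tilted_eq`) identifies these
with the Gaussian integral, that is, with `2πK(x,s)` and `-2πi ∂ₓK(x,s)` for the heat kernel `K`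
(`contourIntegral_exp`, `contourIntegral_mul_exp`). Hence (`fokas_eq_dirichletSolution`)
`u(x,t) = ∫₀^∞ (K(x-y,t) - K(x+y,t)) u₀(y) dy - 2 ∫₀^t ∂ₓK(x,t-τ) g₀(τ) dτ`.

*Interior.* The kernel, extended by zero to `t ≤ 0`, is smooth off the origin, and its derivatives
`Kₙ = ∂ₓⁿK` satisfy `∂ₓKₙ = Kₙ₊₁`, `∂ₜKₙ = Kₙ₊₂` and `|x|^M |Kₙ| ≤ C t^{(M-n-1)/2}`
(`heatKernel_bound`). Potentials may therefore be differentiated under the integral sign wherever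
the point keeps away from the sources, and `F n = ∂ₓⁿu` is a hierarchy with `∂ₓF n = F (n+1)`,
`∂ₜF n = F (n+2)` (`isHeatHierarchy_dirichletSolution`). This gives smoothness and the heat equation;
the decay as `x → ∞` follows from the bounds on the kernel and the moments of `u₀`.

*Boundary.* Near a boundary point only the nearby sources are singular. On them, integration by
parts moves the derivatives from the kernel to the smooth datum, down to a kernel with a bounded
primitive (`heatStep`, `heatRamp`), for which dominated convergence applies
(`tendsto_integral_heatKernel_initial`, `tendsto_integral_heatKernel_boundary`). So every `F n` has
limits at `t = 0` and at `x = 0`; the former are the derivatives of `u₀`, and the latter inherit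
`gₙ' = gₙ₊₂` because the limits are locally uniform in time (`hasDerivAt_trace`).
-/

/-! ### The heat kernel and its derivatives -/

/-- The `n`-th space derivative `∂ₓⁿ K` of the heat kernel `K(x,t) = (4πt)^{-1/2} e^{-x²/(4t)}`,
given by the Hermite recursion. Since `√(4πt) = 0` for `t ≤ 0`, it is extended by zero to `t ≤ 0`,
which makes it smooth on the plane without the origin. -/
noncomputable def heatKernel : ℕ → ℝ → ℝ → ℝ
  | 0, x, t => (√(4 * Real.pi * t))⁻¹ * Real.exp (-x ^ 2 / (4 * t))
  | 1, x, t => -(x / (2 * t)) * heatKernel 0 x t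
  | n + 2, x, t => -((n + 1) / (2 * t)) * heatKernel n x t - x / (2 * t) * heatKernel (n + 1) x t

lemma heatKernel_of_nonpos (n : ℕ) (x : ℝ) {t : ℝ} (ht : t ≤ 0) : heatKernel n x t = 0 := by
  induction n using Nat.twoStepInduction with
  | zero =>
    have : √(4 * Real.pi * t) = 0 :=
      Real.sqrt_eq_zero_of_nonpos (mul_nonpos_of_nonneg_of_nonpos (by positivity) ht)
    simp [heatKernel, this]
  | one =>
    have : √(4 * Real.pi * t) = 0 :=
      Real.sqrt_eq_zero_of_nonpos (mul_nonpos_of_nonneg_of_nonpos (by positivity) ht)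
    simp [heatKernel, this]
  | more n h0 h1 => simp [heatKernel, h0, h1]

lemma hasDerivAt_heatKernel_space (n : ℕ) (x t : ℝ) :
    HasDerivAt (fun y => heatKernel n y t) (heatKernel (n + 1) x t) x := by
  rcases le_or_gt t 0 with ht | ht
  · simp only [heatKernel_of_nonpos _ _ ht]
    exact hasDerivAt_const _ _
  have h0 : ∀ x, HasDerivAt (fun y => heatKernel 0 y t) (heatKernel 1 x t) x := by
    intro x
    have h := (((hasDerivAt_id x).fun_pow 2).fun_neg.div_const (4 * t)).exp.const_mul
      (√(4 * Real.pi * t))⁻¹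
    simp only [heatKernel]
    refine h.congr_deriv ?_
    simp
    field_simp
    ring
  have h1 : ∀ x, HasDerivAt (fun y => heatKernel 1 y t) (heatKernel 2 x t) x := by
    intro x
    have h := (((hasDerivAt_id x).div_const (2 * t)).fun_neg).fun_mul (h0 x)
    have e : (fun y => heatKernel 1 y t) = fun y => -(id y / (2 * t)) * heatKernel 0 y t := by
      ext y; simp [heatKernel]
    rw [e]
    refine h.congr_deriv ?_
    simp [heatKernel]
  induction n using Nat.twoStepInduction generalizing x with
  | zero => exact h0 x
  | one => exact h1 x
  | more n i0 i1 =>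
    have h := ((i0 x).const_mul (-((n + 1) / (2 * t)))).fun_sub
      (((hasDerivAt_id x).div_const (2 * t)).fun_mul (i1 x))
    have e : (fun y => heatKernel (n + 2) y t) = fun y => -((n + 1) / (2 * t)) * heatKernel n y t
        - id y / (2 * t) * heatKernel (n + 1) y t := by
      ext y; simp [heatKernel]
    rw [e]
    refine h.congr_deriv ?_
    rw [show heatKernel (n + 2 + 1) x t = -(((n + 1 : ℕ) + 1) / (2 * t)) * heatKernel (n + 1) x t
      - x / (2 * t) * heatKernel (n + 1 + 1) x t from rfl]
    simp
    field_simp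
    ring

lemma hasDerivAt_heatKernel_time_of_pos (n : ℕ) (x : ℝ) {t : ℝ} (ht : 0 < t) :
    HasDerivAt (fun s => heatKernel n x s) (heatKernel (n + 2) x t) t := by
  have hq : ∀ c : ℝ, HasDerivAt (fun s => c / (2 * s)) (-c / (2 * t ^ 2)) t := by
    intro c
    have := (hasDerivAt_const t c).fun_div ((hasDerivAt_id t).const_mul 2) (by simp [ht.ne'])
    refine this.congr_deriv ?_
    simp
    field_simp
  have h0 : HasDerivAt (fun s => heatKernel 0 x s) (heatKernel 2 x t) t := by
    have hs : HasDerivAt (fun s : ℝ => (√(4 * Real.pi * s))⁻¹)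
        (-(1 / (2 * t)) * (√(4 * Real.pi * t))⁻¹) t := by
      have hp : 0 < 4 * Real.pi * t := by positivity
      have h := (((hasDerivAt_id t).const_mul (4 * Real.pi)).sqrt hp.ne').fun_inv
        (Real.sqrt_pos.2 hp).ne'
      refine h.congr_deriv ?_
      have hsq : √(4 * Real.pi * t) ^ 2 = 4 * Real.pi * t := Real.sq_sqrt hp.le
      have hsp := (Real.sqrt_pos.2 hp).ne'
      simp only [id, mul_one]
      rw [hsq]
      field_simp
    have he := ((hasDerivAt_const t (-x ^ 2)).fun_div ((hasDerivAt_id t).const_mul 4)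
      (by simp [ht.ne'])).exp
    have h := hs.fun_mul he
    have e : (fun s => heatKernel 0 x s) = fun s => (√(4 * Real.pi * s))⁻¹ *
      Real.exp (-x ^ 2 / (4 * id s)) := by ext s; simp [heatKernel]
    rw [e]
    refine h.congr_deriv ?_
    simp [heatKernel]
    field_simp
    ring
  have h1 : HasDerivAt (fun s => heatKernel 1 x s) (heatKernel 3 x t) t := by
    have h := (hq x).fun_neg.fun_mul h0
    have e : (fun s => heatKernel 1 x s) = fun s => -(x / (2 * s)) * heatKernel 0 x s := by
      ext s; simp [heatKernel]
    rw [e]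
    refine h.congr_deriv ?_
    simp [heatKernel]
    field_simp
    ring
  induction n using Nat.twoStepInduction with
  | zero => exact h0
  | one => exact h1
  | more n i0 i1 =>
    have h := ((hq (n + 1)).fun_neg.fun_mul i0).fun_sub ((hq x).fun_mul i1)
    have e : (fun s => heatKernel (n + 2) x s) = fun s => -((n + 1) / (2 * s)) * heatKernel n x s
        - x / (2 * s) * heatKernel (n + 1) x s := by
      ext y; simp [heatKernel]
    rw [e]
    refine h.congr_deriv ?_
    rw [show heatKernel (n + 2 + 2) x t = -(((n + 2 : ℕ) + 1) / (2 * t)) * heatKernel (n + 2) x t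
      - x / (2 * t) * heatKernel (n + 1 + 2) x t from rfl,
      show heatKernel (n + 2) x t = -((n + 1) / (2 * t)) * heatKernel n x t
        - x / (2 * t) * heatKernel (n + 1) x t from rfl]
    push_cast
    field_simp
    ring

/-- The parabolic scaling bound `|x|^M |∂ₓⁿ K(x,t)| ≤ C t^{(M-n-1)/2}`. -/
lemma heatKernel_bound (n M : ℕ) : ∃ C : ℝ, 0 ≤ C ∧ ∀ x t : ℝ, 0 < t →
    |x| ^ M * |heatKernel n x t| * √t ^ (n + 1) ≤ C * √t ^ M := by
  have h0 : ∀ M : ℕ, ∃ C : ℝ, 0 ≤ C ∧ ∀ x t : ℝ, 0 < t →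
      |x| ^ M * |heatKernel 0 x t| * √t ^ (0 + 1) ≤ C * √t ^ M := by
    intro M
    -- `w ^ M * exp (-w² / 4)` is bounded because `(w²) ^ M / M!` is a term of the series of `exp w²`
    refine ⟨1 + 4 ^ M * M.factorial, by positivity, fun x t ht => ?_⟩
    obtain ⟨r, hr, rfl⟩ : ∃ r : ℝ, 0 < r ∧ t = r ^ 2 :=
      ⟨√t, Real.sqrt_pos.2 ht, (Real.sq_sqrt ht.le).symm⟩
    obtain ⟨w, rfl⟩ : ∃ w, x = w * r := ⟨x / r, by field_simp⟩
    rw [Real.sqrt_sq hr.le]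
    have e1 : heatKernel 0 (w * r) (r ^ 2) = (√(4 * Real.pi))⁻¹ * r⁻¹ * Real.exp (-(w ^ 2 / 4)) := by
      simp only [heatKernel]
      rw [Real.sqrt_mul (by positivity), Real.sqrt_sq hr.le, mul_inv]
      congr 2
      field_simp
    have e2 : (√(4 * Real.pi))⁻¹ ≤ 1 := by
      apply inv_le_one_of_one_le₀
      rw [Real.one_le_sqrt]
      linarith [Real.pi_gt_three]
    have e3 : |w| ^ M * Real.exp (-(w ^ 2 / 4)) ≤ 1 + 4 ^ M * M.factorial := by
      have h1 : |w| ^ M ≤ 1 + (w ^ 2) ^ M := by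
        rw [← sq_abs, ← pow_mul, mul_comm, pow_mul]
        nlinarith [sq_nonneg (|w| ^ M - 1), sq_nonneg (|w| ^ M)]
      have h2 : (w ^ 2 / 4) ^ M / M.factorial ≤ Real.exp (w ^ 2 / 4) :=
        Real.pow_div_factorial_le_exp _ (by positivity) _
      have h3 : (w ^ 2) ^ M ≤ 4 ^ M * M.factorial * Real.exp (w ^ 2 / 4) := by
        rw [div_pow, div_div, div_le_iff₀ (by positivity)] at h2
        linarith
      have h4 : 1 ≤ Real.exp (w ^ 2 / 4) := Real.one_le_exp (by positivity)
      rw [Real.exp_neg, ← div_eq_mul_inv, div_le_iff₀ (Real.exp_pos _)]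
      linarith
    rw [e1, abs_mul w r, mul_pow, abs_of_pos hr,
      abs_of_nonneg (show 0 ≤ (√(4 * Real.pi))⁻¹ * r⁻¹ * Real.exp (-(w ^ 2 / 4)) by positivity)]
    calc |w| ^ M * r ^ M * ((√(4 * Real.pi))⁻¹ * r⁻¹ * Real.exp (-(w ^ 2 / 4))) * r ^ (0 + 1)
        = (√(4 * Real.pi))⁻¹ * (|w| ^ M * Real.exp (-(w ^ 2 / 4))) * r ^ M := by
          field_simp
          ring
      _ ≤ 1 * (1 + 4 ^ M * M.factorial) * r ^ M := by gcongr
      _ = _ := by ring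
  induction n using Nat.twoStepInduction generalizing M with
  | zero => exact h0 M
  | one =>
    obtain ⟨C, hC, h⟩ := h0 (M + 1)
    refine ⟨C, hC, fun x t ht => ?_⟩
    have h' := h x t ht
    have hr := Real.sqrt_pos.2 ht
    have ht2 : t = √t ^ 2 := (Real.sq_sqrt ht.le).symm
    simp only [heatKernel.eq_2, abs_mul, abs_neg, abs_div, abs_of_pos ht, abs_two]
    calc |x| ^ M * (|x| / (2 * t) * |heatKernel 0 x t|) * √t ^ (1 + 1)
        = (|x| ^ (M + 1) * |heatKernel 0 x t| * √t ^ (0 + 1)) / (2 * √t) := by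
          rw [show |x| / (2 * t) = |x| / (2 * √t ^ 2) by rw [← ht2]]
          field_simp
          ring
      _ ≤ (C * √t ^ (M + 1)) / (2 * √t) := by gcongr
      _ = C * √t ^ M / 2 := by field_simp; ring
      _ ≤ C * √t ^ M := half_le_self (by positivity)
  | more n i0 i1 =>
    obtain ⟨C, hC, h⟩ := i0 M
    obtain ⟨D, hD, h'⟩ := i1 (M + 1)
    refine ⟨(n + 1) / 2 * C + D / 2, by positivity, fun x t ht => ?_⟩
    have hr := Real.sqrt_pos.2 ht
    have ht2 : t = √t ^ 2 := (Real.sq_sqrt ht.le).symm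
    have e1 : |heatKernel (n + 2) x t| ≤
        (n + 1) / (2 * t) * |heatKernel n x t| + |x| / (2 * t) * |heatKernel (n + 1) x t| := by
      rw [heatKernel.eq_3]
      refine (abs_sub _ _).trans ?_
      rw [abs_mul, abs_mul, abs_neg, abs_div, abs_div, abs_of_pos (show 0 < 2 * t by positivity),
        abs_of_pos (show (0 : ℝ) < n + 1 by positivity)]
    calc |x| ^ M * |heatKernel (n + 2) x t| * √t ^ (n + 2 + 1)
        ≤ |x| ^ M * ((n + 1) / (2 * t) * |heatKernel n x t| +
          |x| / (2 * t) * |heatKernel (n + 1) x t|) * √t ^ (n + 2 + 1) := by gcongr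
      _ = (n + 1) / 2 * (|x| ^ M * |heatKernel n x t| * √t ^ (n + 1)) +
          (|x| ^ (M + 1) * |heatKernel (n + 1) x t| * √t ^ (n + 1 + 1)) / (2 * √t) := by
          rw [show (n + 1 : ℝ) / (2 * t) = (n + 1) / (2 * √t ^ 2) by rw [← ht2],
            show |x| / (2 * t) = |x| / (2 * √t ^ 2) by rw [← ht2]]
          field_simp
          ring
      _ ≤ (n + 1) / 2 * (C * √t ^ M) + (D * √t ^ (M + 1)) / (2 * √t) := by
          exact add_le_add (mul_le_mul_of_nonneg_left (h x t ht) (by positivity))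
            (div_le_div_of_nonneg_right (h' x t ht) (by positivity))
      _ = _ := by field_simp; ring

/-- Away from `x = 0` the kernel is controlled by any power of `t`, uniformly down to `t = 0`. -/
lemma heatKernel_bound_space (n k : ℕ) : ∃ C : ℝ, 0 ≤ C ∧ ∀ x t : ℝ,
    |x| ^ (n + 1 + 2 * k) * |heatKernel n x t| ≤ C * |t| ^ k := by
  obtain ⟨C, hC, h⟩ := heatKernel_bound n (n + 1 + 2 * k)
  refine ⟨C, hC, fun x t => ?_⟩
  rcases le_or_gt t 0 with ht | ht
  · rw [heatKernel_of_nonpos n x ht]; simp; positivity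
  have hr := Real.sqrt_pos.2 ht
  have := h x t ht
  rw [pow_add √t (n + 1), mul_comm (√t ^ (n + 1)) (√t ^ (2 * k)), ← mul_assoc C, pow_mul √t,
    Real.sq_sqrt ht.le] at this
  rw [abs_of_pos ht]
  exact le_of_mul_le_mul_right this (by positivity)

lemma heatKernel_bound_far (n : ℕ) {δ : ℝ} (hδ : 0 < δ) : ∃ C : ℝ, 0 ≤ C ∧ ∀ x t : ℝ,
    (δ ≤ |x| ∨ δ ≤ t) → |heatKernel n x t| ≤ C := by
  obtain ⟨C, hC, h⟩ := heatKernel_bound_space n 0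
  obtain ⟨D, hD, h'⟩ := heatKernel_bound n 0
  refine ⟨C / δ ^ (n + 1) + D / √δ ^ (n + 1), by positivity, fun x t hxt => ?_⟩
  have hr := Real.sqrt_pos.2 hδ
  rcases hxt with hx | ht
  · have h1 : |heatKernel n x t| ≤ C / δ ^ (n + 1) := by
      rw [le_div_iff₀ (by positivity), mul_comm]
      refine le_trans ?_ ((h x t).trans (by simp))
      gcongr
    have : 0 ≤ D / √δ ^ (n + 1) := by positivity
    linarith
  · have h1 : |heatKernel n x t| ≤ D / √δ ^ (n + 1) := by
      rw [le_div_iff₀ (by positivity)]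
      refine le_trans ?_ ((h' x t (hδ.trans_le ht)).trans (by simp))
      rw [pow_zero, one_mul]
      gcongr
    have : 0 ≤ C / δ ^ (n + 1) := by positivity
    linarith

lemma measurable_heatKernel (n : ℕ) : Measurable (fun p : ℝ × ℝ => heatKernel n p.1 p.2) := by
  induction n using Nat.twoStepInduction with
  | zero => simp only [heatKernel]; fun_prop
  | one => simp only [heatKernel]; fun_prop
  | more n i0 i1 => simp only [heatKernel.eq_3]; fun_prop

lemma continuousAt_heatKernel (n : ℕ) {p : ℝ × ℝ} (hp : p.1 ≠ 0 ∨ p.2 ≠ 0) :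
    ContinuousAt (fun p : ℝ × ℝ => heatKernel n p.1 p.2) p := by
  by_cases ht : p.2 = 0
  · have hx : p.1 ≠ 0 := by tauto
    obtain ⟨C, hC, h⟩ := heatKernel_bound_space n 1
    have hlim : Tendsto (fun q : ℝ × ℝ => C * |q.2| ^ 1 / |q.1| ^ (n + 1 + 2 * 1)) (𝓝 p) (𝓝 0) := by
      have : ContinuousAt (fun q : ℝ × ℝ => C * |q.2| ^ 1 / |q.1| ^ (n + 1 + 2 * 1)) p := by
        refine ContinuousAt.div (by fun_prop) (by fun_prop) ?_
        positivity
      simpa [ContinuousAt, ht] using this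
    rw [ContinuousAt, ht, heatKernel_of_nonpos n _ le_rfl]
    refine squeeze_zero_norm' ?_ hlim
    have : ∀ᶠ q : ℝ × ℝ in 𝓝 p, q.1 ≠ 0 := continuousAt_fst.eventually_ne hx
    filter_upwards [this] with q hq
    rw [Real.norm_eq_abs, le_div_iff₀ (by positivity), mul_comm]
    exact h _ _
  · have hq : ∀ f : ℝ × ℝ → ℝ, ContinuousAt f p → ContinuousAt (fun q : ℝ × ℝ => f q / (2 * q.2)) p :=
      fun f hf => hf.div (by fun_prop) (by simpa using ht)
    rcases lt_or_gt_of_ne ht with ht | ht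
    · have : (fun q : ℝ × ℝ => heatKernel n q.1 q.2) =ᶠ[𝓝 p] fun _ => 0 := by
        filter_upwards [continuousAt_snd.eventually_lt_const ht] with q hq
        exact heatKernel_of_nonpos n _ hq.le
      exact continuousAt_const.congr this.symm
    induction n using Nat.twoStepInduction with
    | zero =>
      simp only [heatKernel]
      refine ContinuousAt.mul (ContinuousAt.inv₀ (by fun_prop) ?_)
        (ContinuousAt.rexp (ContinuousAt.div (by fun_prop) (by fun_prop) (by positivity)))
      exact (Real.sqrt_pos.2 (by positivity)).ne'
    | one =>
      simp only [heatKernel]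
      refine ContinuousAt.mul (hq _ (by fun_prop)).neg
        (ContinuousAt.mul (ContinuousAt.inv₀ (by fun_prop) ?_)
        (ContinuousAt.rexp (ContinuousAt.div (by fun_prop) (by fun_prop) (by positivity))))
      exact (Real.sqrt_pos.2 (by positivity)).ne'
    | more n i0 i1 =>
      simp only [heatKernel.eq_3]
      exact ((hq _ (by fun_prop)).neg.mul i0).sub ((hq _ (by fun_prop)).mul i1)

/-- The heat equation holds across `t = 0` away from `x = 0`, where the kernel is `O(t²)`. -/
lemma hasDerivAt_heatKernel_time (n : ℕ) {x t : ℝ} (h : x ≠ 0 ∨ t ≠ 0) :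
    HasDerivAt (fun s => heatKernel n x s) (heatKernel (n + 2) x t) t := by
  rcases lt_trichotomy t 0 with ht | rfl | ht
  · rw [heatKernel_of_nonpos _ _ ht.le]
    refine (hasDerivAt_const t (0 : ℝ)).congr_of_eventuallyEq ?_
    filter_upwards [gt_mem_nhds ht] with s hs using heatKernel_of_nonpos n _ (le_of_lt hs)
  · have hx : x ≠ 0 := by tauto
    obtain ⟨C, hC, h⟩ := heatKernel_bound_space n 2
    rw [heatKernel_of_nonpos _ _ le_rfl, hasDerivAt_iff_isLittleO, heatKernel_of_nonpos _ _ le_rfl]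
    have h1 : (fun s => heatKernel n x s) =O[𝓝 0] fun s : ℝ => s ^ 2 := by
      refine Asymptotics.IsBigO.of_bound (C / |x| ^ (n + 1 + 2 * 2)) (Eventually.of_forall fun s => ?_)
      rw [div_mul_eq_mul_div, le_div_iff₀ (by positivity), mul_comm]
      simpa using h x s
    have h2 : (fun s : ℝ => s ^ 2) =o[𝓝 0] fun s : ℝ => s := by
      simpa using Asymptotics.isLittleO_pow_pow (𝕜 := ℝ) (show 1 < 2 by norm_num)
    simpa using h1.trans_isLittleO h2
  · exact hasDerivAt_heatKernel_time_of_pos n x ht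

/-! ### Heat potentials away from their sources -/

/-- The superposition `∫_S ∂ₓⁿK(x - ξ(a), t - τ(a)) w(a) da` of (derivatives of) heat kernels with
sources at the points `(ξ(a), τ(a))`, `a ∈ S`, and density `w`. The initial datum is spread along
`τ = 0`, the boundary datum along `ξ = 0`. -/
noncomputable def heatPotential (n : ℕ) (S : Set ℝ) (ξ τ : ℝ → ℝ) (w : ℝ → ℂ) (x t : ℝ) : ℂ :=
  ∫ a in S, heatKernel n (x - ξ a) (t - τ a) • w a

/-- The point `(x, t)` keeps distance `δ` from the sources in `S`, or is later than they are by at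
least `δ`. -/
def FarFromSources (δ : ℝ) (S : Set ℝ) (ξ τ : ℝ → ℝ) (x t : ℝ) : Prop :=
  ∀ a ∈ S, δ ≤ |x - ξ a| ∨ δ ≤ t - τ a

lemma FarFromSources.of_near {δ : ℝ} {S : Set ℝ} {ξ τ : ℝ → ℝ} {x t x' t' : ℝ}
    (h : FarFromSources δ S ξ τ x t) (hx : |x' - x| ≤ δ / 2) (ht : |t' - t| ≤ δ / 2) :
    FarFromSources (δ / 2) S ξ τ x' t' := by
  intro a ha
  rcases h a ha with h | h
  · left
    have := abs_sub_abs_le_abs_sub (x - ξ a) (x' - ξ a)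
    rw [sub_sub_sub_cancel_right, abs_sub_comm x x'] at this
    linarith
  · right
    have := (abs_le.1 ht).1
    linarith

section Potential

variable {δ : ℝ} {S : Set ℝ} {ξ τ : ℝ → ℝ} {w : ℝ → ℂ}

lemma aestronglyMeasurable_heatPotential_integrand (n : ℕ) (hξ : Measurable ξ) (hτ : Measurable τ)
    (hw : AEStronglyMeasurable w (volume.restrict S)) (x t : ℝ) :
    AEStronglyMeasurable (fun a => heatKernel n (x - ξ a) (t - τ a) • w a) (volume.restrict S) := by
  have h : Measurable fun a => heatKernel n (x - ξ a) (t - τ a) :=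
    (measurable_heatKernel n).comp ((measurable_const.sub hξ).prodMk (measurable_const.sub hτ))
  exact h.aestronglyMeasurable.smul hw

lemma integrableOn_heatPotential_integrand (n : ℕ) (hS : MeasurableSet S) (hξ : Measurable ξ)
    (hτ : Measurable τ) (hw : IntegrableOn w S) (hδ : 0 < δ) {x t : ℝ}
    (h : FarFromSources δ S ξ τ x t) :
    IntegrableOn (fun a => heatKernel n (x - ξ a) (t - τ a) • w a) S := by
  obtain ⟨C, hC, hb⟩ := heatKernel_bound_far n hδ
  refine Integrable.mono' (hw.norm.const_mul C)
    (aestronglyMeasurable_heatPotential_integrand n hξ hτ hw.1 x t) ?_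
  filter_upwards [ae_restrict_mem hS] with a ha
  rw [norm_smul, Real.norm_eq_abs]
  exact mul_le_mul_of_nonneg_right (hb _ _ (h a ha)) (norm_nonneg _)

lemma continuousAt_heatPotential (n : ℕ) (hS : MeasurableSet S) (hξ : Measurable ξ)
    (hτ : Measurable τ) (hw : IntegrableOn w S) (hδ : 0 < δ) {p : ℝ × ℝ}
    (h : FarFromSources δ S ξ τ p.1 p.2) :
    ContinuousAt (fun q : ℝ × ℝ => heatPotential n S ξ τ w q.1 q.2) p := by
  obtain ⟨C, hC, hb⟩ := heatKernel_bound_far n (half_pos hδ)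
  unfold heatPotential
  refine continuousAt_of_dominated (bound := fun a => C * ‖w a‖)
    (Eventually.of_forall fun q =>
      aestronglyMeasurable_heatPotential_integrand n hξ hτ hw.1 q.1 q.2) ?_
    (hw.norm.const_mul C) ?_
  · have h1 : ∀ᶠ q : ℝ × ℝ in 𝓝 p, |q.1 - p.1| < δ / 2 := by
      have : ContinuousAt (fun q : ℝ × ℝ => |q.1 - p.1|) p := by fun_prop
      exact this.eventually_lt_const (by simpa using hδ)
    have h2 : ∀ᶠ q : ℝ × ℝ in 𝓝 p, |q.2 - p.2| < δ / 2 := by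
      have : ContinuousAt (fun q : ℝ × ℝ => |q.2 - p.2|) p := by fun_prop
      exact this.eventually_lt_const (by simpa using hδ)
    filter_upwards [h1, h2] with q hq1 hq2
    filter_upwards [ae_restrict_mem hS] with a ha
    rw [norm_smul, Real.norm_eq_abs]
    exact mul_le_mul_of_nonneg_right (hb _ _ (h.of_near hq1.le hq2.le a ha)) (norm_nonneg _)
  · filter_upwards [ae_restrict_mem hS] with a ha
    have hne : p.1 - ξ a ≠ 0 ∨ p.2 - τ a ≠ 0 := by
      rcases h a ha with h | h
      · exact Or.inl (abs_pos.1 (hδ.trans_le h))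
      · exact Or.inr (hδ.trans_le h).ne'
    have h3 : ContinuousAt (fun q : ℝ × ℝ => (q.1 - ξ a, q.2 - τ a)) p := by fun_prop
    exact (ContinuousAt.comp (f := fun q : ℝ × ℝ => (q.1 - ξ a, q.2 - τ a))
      (continuousAt_heatKernel n (p := (p.1 - ξ a, p.2 - τ a)) hne) h3).smul continuousAt_const

lemma hasDerivAt_heatPotential_space (n : ℕ) (hS : MeasurableSet S) (hξ : Measurable ξ)
    (hτ : Measurable τ) (hw : IntegrableOn w S) (hδ : 0 < δ) {x t : ℝ}
    (h : FarFromSources δ S ξ τ x t) :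
    HasDerivAt (fun y => heatPotential n S ξ τ w y t) (heatPotential (n + 1) S ξ τ w x t) x := by
  obtain ⟨C, hC, hb⟩ := heatKernel_bound_far (n + 1) (half_pos hδ)
  refine (hasDerivAt_integral_of_dominated_loc_of_deriv_le (bound := fun a => C * ‖w a‖)
    (F' := fun y a => heatKernel (n + 1) (y - ξ a) (t - τ a) • w a)
    (Metric.closedBall_mem_nhds x (half_pos hδ)) (Eventually.of_forall fun y =>
      aestronglyMeasurable_heatPotential_integrand n hξ hτ hw.1 y t)
    (integrableOn_heatPotential_integrand n hS hξ hτ hw hδ h)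
    (aestronglyMeasurable_heatPotential_integrand (n + 1) hξ hτ hw.1 x t) ?_
    (hw.norm.const_mul C) ?_).2
  · filter_upwards [ae_restrict_mem hS] with a ha y hy
    rw [norm_smul, Real.norm_eq_abs]
    exact mul_le_mul_of_nonneg_right
      (hb _ _ (h.of_near hy (by rw [sub_self, abs_zero]; exact (half_pos hδ).le) a ha)) (norm_nonneg _)
  · filter_upwards with a y _
    exact ((hasDerivAt_heatKernel_space n (y - ξ a) (t - τ a)).comp_sub_const y (ξ a)).smul_const _

lemma hasDerivAt_heatPotential_time (n : ℕ) (hS : MeasurableSet S) (hξ : Measurable ξ)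
    (hτ : Measurable τ) (hw : IntegrableOn w S) (hδ : 0 < δ) {x t : ℝ}
    (h : FarFromSources δ S ξ τ x t) :
    HasDerivAt (fun s => heatPotential n S ξ τ w x s) (heatPotential (n + 2) S ξ τ w x t) t := by
  obtain ⟨C, hC, hb⟩ := heatKernel_bound_far (n + 2) (half_pos hδ)
  refine (hasDerivAt_integral_of_dominated_loc_of_deriv_le (bound := fun a => C * ‖w a‖)
    (F' := fun s a => heatKernel (n + 2) (x - ξ a) (s - τ a) • w a)
    (Metric.closedBall_mem_nhds t (half_pos hδ)) (Eventually.of_forall fun s =>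
      aestronglyMeasurable_heatPotential_integrand n hξ hτ hw.1 x s)
    (integrableOn_heatPotential_integrand n hS hξ hτ hw hδ h)
    (aestronglyMeasurable_heatPotential_integrand (n + 2) hξ hτ hw.1 x t) ?_
    (hw.norm.const_mul C) ?_).2
  · filter_upwards [ae_restrict_mem hS] with a ha s hs
    rw [norm_smul, Real.norm_eq_abs]
    exact mul_le_mul_of_nonneg_right
      (hb _ _ (h.of_near (by rw [sub_self, abs_zero]; exact (half_pos hδ).le) hs a ha)) (norm_nonneg _)
  · filter_upwards [ae_restrict_mem hS] with a ha s hs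
    have hne : x - ξ a ≠ 0 ∨ s - τ a ≠ 0 := by
      rcases h.of_near (by rw [sub_self, abs_zero]; exact (half_pos hδ).le) hs a ha with h | h
      · exact Or.inl (abs_pos.1 ((half_pos hδ).trans_le h))
      · exact Or.inr ((half_pos hδ).trans_le h).ne'
    exact ((hasDerivAt_heatKernel_time n hne).comp_sub_const s (τ a)).smul_const _

end Potential

/-! ### Primitives of the heat kernel -/

lemma heatKernel_zero_one (y : ℝ) :
    heatKernel 0 y 1 = (√(4 * Real.pi))⁻¹ * Real.exp (-(1 / 4) * y ^ 2) := by
  simp only [heatKernel, mul_one]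
  congr 2
  ring

lemma continuous_heatKernel_one : Continuous fun y => heatKernel 0 y 1 := by
  simp only [heatKernel_zero_one]
  fun_prop

lemma integrable_heatKernel_one : Integrable fun y => heatKernel 0 y 1 := by
  simp only [heatKernel_zero_one]
  exact (integrable_exp_neg_mul_sq (by norm_num)).const_mul _

lemma tendsto_integral_heatKernel_atTop :
    Tendsto (fun z => ∫ y in (0 : ℝ)..z, heatKernel 0 y 1) atTop (𝓝 (1 / 2)) := by
  have h := intervalIntegral_tendsto_integral_Ioi (0 : ℝ)
    integrable_heatKernel_one.integrableOn tendsto_id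
  have hval : ∫ y in Ioi (0 : ℝ), heatKernel 0 y 1 = 1 / 2 := by
    simp only [heatKernel_zero_one]
    rw [integral_const_mul, integral_gaussian_Ioi,
      show Real.pi / (1 / 4) = 4 * Real.pi by ring]
    have : √(4 * Real.pi) ≠ 0 := (Real.sqrt_pos.2 (by positivity)).ne'
    field_simp
  rwa [hval] at h

lemma integral_heatKernel_neg (z : ℝ) :
    ∫ y in (0 : ℝ)..-z, heatKernel 0 y 1 = -∫ y in (0 : ℝ)..z, heatKernel 0 y 1 := by
  have h := intervalIntegral.integral_comp_neg (a := 0) (b := z) fun y => heatKernel 0 y 1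
  have e : ∀ y, heatKernel 0 (-y) 1 = heatKernel 0 y 1 := fun y => by simp [heatKernel_zero_one]
  simp only [e, neg_zero] at h
  rw [h, ← intervalIntegral.integral_symm]

lemma tendsto_integral_heatKernel_atBot :
    Tendsto (fun z => ∫ y in (0 : ℝ)..z, heatKernel 0 y 1) atBot (𝓝 (-(1 / 2))) := by
  have h := (tendsto_integral_heatKernel_atTop.comp tendsto_neg_atBot_atTop).neg
  refine h.congr fun z => ?_
  simp [integral_heatKernel_neg]

lemma integral_heatKernel_bound : ∃ C : ℝ, ∀ z, |∫ y in (0 : ℝ)..z, heatKernel 0 y 1| ≤ C := by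
  refine ⟨∫ y, ‖heatKernel 0 y 1‖, fun z => ?_⟩
  rw [← Real.norm_eq_abs]
  refine intervalIntegral.norm_integral_le_integral_norm_uIoc.trans ?_
  exact setIntegral_le_integral integrable_heatKernel_one.norm
    (Eventually.of_forall fun _ => norm_nonneg _)

/-- The space primitive of the heat kernel that vanishes as `t → 0⁺` for `x > 0`, namely
`-½ erfc(x / √(4t))`, extended by zero to `t ≤ 0`. It plays the role of `∂ₓ⁻¹ K`. -/
noncomputable def heatStep (x t : ℝ) : ℝ :=
  if 0 < t then (∫ y in (0 : ℝ)..x / √t, heatKernel 0 y 1) - 1 / 2 else 0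

lemma heatStep_of_pos (x : ℝ) {t : ℝ} (ht : 0 < t) :
    heatStep x t = (∫ y in (0 : ℝ)..x / √t, heatKernel 0 y 1) - 1 / 2 := if_pos ht

lemma heatStep_of_nonpos (x : ℝ) {t : ℝ} (ht : t ≤ 0) : heatStep x t = 0 := if_neg ht.not_gt

lemma heatStep_bound : ∃ C : ℝ, 0 ≤ C ∧ ∀ x t, |heatStep x t| ≤ C := by
  obtain ⟨C, h⟩ := integral_heatKernel_bound
  have hC : 0 ≤ C := (abs_nonneg _).trans (h 0)
  refine ⟨C + 1 / 2, by positivity, fun x t => ?_⟩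
  unfold heatStep
  split_ifs
  · refine (abs_sub _ _).trans ?_
    rw [abs_of_pos (show (0 : ℝ) < 1 / 2 by norm_num)]
    linarith [h (x / √t)]
  · simp; positivity

lemma hasDerivAt_integral_heatKernel (z : ℝ) :
    HasDerivAt (fun z => ∫ y in (0 : ℝ)..z, heatKernel 0 y 1) (heatKernel 0 z 1) z :=
  intervalIntegral.integral_hasDerivAt_right
    (continuous_heatKernel_one.intervalIntegrable _ _)
    (continuous_heatKernel_one.stronglyMeasurableAtFilter _ _) continuous_heatKernel_one.continuousAt

lemma heatKernel_zero_scale (x : ℝ) {t : ℝ} (ht : 0 < t) :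
    heatKernel 0 x t = (√t)⁻¹ * heatKernel 0 (x / √t) 1 := by
  rw [heatKernel_zero_one, heatKernel, Real.sqrt_mul (by positivity), div_pow, Real.sq_sqrt ht.le,
    mul_inv]
  rw [show -x ^ 2 / (4 * t) = -(1 / 4) * (x ^ 2 / t) by field_simp]
  ring

lemma hasDerivAt_heatStep_space (x : ℝ) {t : ℝ} (ht : 0 < t) :
    HasDerivAt (fun y => heatStep y t) (heatKernel 0 x t) x := by
  have h := ((hasDerivAt_integral_heatKernel (x / √t)).comp x
    ((hasDerivAt_id x).div_const √t)).sub_const (1 / 2)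
  have e : (fun y => heatStep y t) =
      fun y => (∫ y in (0 : ℝ)..y / √t, heatKernel 0 y 1) - 1 / 2 := by
    ext y; exact heatStep_of_pos y ht
  rw [e]
  refine h.congr_deriv ?_
  rw [heatKernel_zero_scale x ht]
  ring

lemma hasDerivAt_heatStep_time (x : ℝ) {t : ℝ} (ht : 0 < t) :
    HasDerivAt (fun s => heatStep x s) (heatKernel 1 x t) t := by
  have hr := Real.sqrt_pos.2 ht
  have h := ((hasDerivAt_integral_heatKernel (x / √t)).comp t
    ((hasDerivAt_const t x).fun_div ((hasDerivAt_id t).sqrt ht.ne') hr.ne')).sub_const (1 / 2)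
  have e : (fun s => heatStep x s) =ᶠ[𝓝 t]
      fun s => (∫ y in (0 : ℝ)..x / √s, heatKernel 0 y 1) - 1 / 2 := by
    filter_upwards [lt_mem_nhds ht] with s hs using heatStep_of_pos x hs
  refine (h.congr_of_eventuallyEq e).congr_deriv ?_
  rw [heatKernel.eq_2, heatKernel_zero_scale x ht]
  simp only [id]
  rw [Real.sq_sqrt ht.le]
  field_simp
  ring

lemma continuousAt_heatStep {p : ℝ × ℝ} (hp : 0 < p.2) :
    ContinuousAt (fun q : ℝ × ℝ => heatStep q.1 q.2) p := by
  have hr := Real.sqrt_pos.2 hp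
  have e : (fun q : ℝ × ℝ => heatStep q.1 q.2) =ᶠ[𝓝 p]
      fun q => (∫ y in (0 : ℝ)..q.1 / √q.2, heatKernel 0 y 1) - 1 / 2 := by
    filter_upwards [continuousAt_snd.eventually_const_lt hp] with q hq using heatStep_of_pos _ hq
  have h1 : ContinuousAt (fun q : ℝ × ℝ => q.1 / √q.2) p :=
    ContinuousAt.div (by fun_prop) (by fun_prop) hr.ne'
  exact ((ContinuousAt.comp (f := fun q : ℝ × ℝ => q.1 / √q.2)
    (hasDerivAt_integral_heatKernel (p.1 / √p.2)).continuousAt h1).sub continuousAt_const).congr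
    e.symm

lemma tendsto_inv_sqrt_snd (x : ℝ) :
    Tendsto (fun p : ℝ × ℝ => (√p.2)⁻¹) (𝓝[{p | 0 < p.2}] (x, 0)) atTop := by
  refine tendsto_inv_nhdsGT_zero.comp (tendsto_nhdsWithin_iff.2 ⟨?_, ?_⟩)
  · have : ContinuousAt (fun p : ℝ × ℝ => √p.2) (x, 0) := by fun_prop
    rw [ContinuousAt, Real.sqrt_zero] at this
    exact this.mono_left nhdsWithin_le_nhds
  · filter_upwards [self_mem_nhdsWithin] with p hp using Real.sqrt_pos.2 hp

/-- As `t → 0⁺` the primitive becomes the step function `-1_{x < 0}`. -/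
lemma tendsto_heatStep_initial_of_pos {x : ℝ} (hx : 0 < x) :
    Tendsto (fun p : ℝ × ℝ => heatStep p.1 p.2) (𝓝[{p | 0 < p.2}] (x, 0)) (𝓝 0) := by
  have h1 : Tendsto (fun p : ℝ × ℝ => p.1) (𝓝[{p | 0 < p.2}] (x, 0)) (𝓝 x) :=
    (continuousAt_fst (p := ((x, 0) : ℝ × ℝ))).mono_left nhdsWithin_le_nhds
  have h2 := (tendsto_integral_heatKernel_atTop.comp
    (h1.pos_mul_atTop hx (tendsto_inv_sqrt_snd x))).sub_const (1 / 2)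
  rw [sub_self] at h2
  refine h2.congr' ?_
  filter_upwards [self_mem_nhdsWithin] with p hp
  rw [heatStep_of_pos _ hp, div_eq_mul_inv p.1]
  rfl

lemma tendsto_heatStep_initial_of_neg {x : ℝ} (hx : x < 0) :
    Tendsto (fun p : ℝ × ℝ => heatStep p.1 p.2) (𝓝[{p | 0 < p.2}] (x, 0)) (𝓝 (-1)) := by
  have h1 : Tendsto (fun p : ℝ × ℝ => p.1) (𝓝[{p | 0 < p.2}] (x, 0)) (𝓝 x) :=
    (continuousAt_fst (p := ((x, 0) : ℝ × ℝ))).mono_left nhdsWithin_le_nhds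
  have h2 := (tendsto_integral_heatKernel_atBot.comp
    (h1.neg_mul_atTop hx (tendsto_inv_sqrt_snd x))).sub_const (1 / 2)
  norm_num at h2
  refine h2.congr' ?_
  filter_upwards [self_mem_nhdsWithin] with p hp
  rw [heatStep_of_pos _ hp, div_eq_mul_inv p.1]

lemma continuous_heatStep_time {x : ℝ} (hx : 0 < x) : Continuous fun s => heatStep x s := by
  rw [continuous_iff_continuousAt]
  intro t
  rcases lt_trichotomy t 0 with ht | rfl | ht
  · refine (continuousAt_const (y := (0 : ℝ))).congr ?_
    filter_upwards [gt_mem_nhds ht] with s hs using (heatStep_of_nonpos x (le_of_lt hs)).symm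
  · have h1 : Tendsto (fun s => heatStep x s) (𝓝[≤] 0) (𝓝 0) := by
      refine tendsto_const_nhds.congr' ?_
      filter_upwards [self_mem_nhdsWithin] with s hs using (heatStep_of_nonpos x hs).symm
    have h2 : Tendsto (fun s => heatStep x s) (𝓝[>] 0) (𝓝 0) := by
      refine (tendsto_heatStep_initial_of_pos hx).comp
        (f := fun s : ℝ => (x, s)) (tendsto_nhdsWithin_iff.2 ⟨?_, ?_⟩)
      · have : ContinuousAt (fun s : ℝ => (x, s)) 0 := by fun_prop
        exact this.mono_left nhdsWithin_le_nhds
      · filter_upwards [self_mem_nhdsWithin] with s hs using hs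
    rw [ContinuousAt, heatStep_of_nonpos x le_rfl]
    simpa [nhdsLE_sup_nhdsGT] using h1.sup h2
  · exact (hasDerivAt_heatStep_time x ht).continuousAt

lemma heatStep_zero {t : ℝ} (ht : 0 < t) : heatStep 0 t = -(1 / 2) := by
  simp [heatStep_of_pos 0 ht]

/-- A second space primitive, `∂ₓ⁻² K`; it is continuous and locally bounded up to `x = 0`. -/
noncomputable def heatRamp (x t : ℝ) : ℝ := x * heatStep x t + 2 * t * heatKernel 0 x t

lemma hasDerivAt_heatRamp_time (x : ℝ) {t : ℝ} (ht : 0 < t) :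
    HasDerivAt (fun s => heatRamp x s) (heatKernel 0 x t) t := by
  have h := ((hasDerivAt_heatStep_time x ht).const_mul x).fun_add
    (((hasDerivAt_id t).const_mul 2).fun_mul (hasDerivAt_heatKernel_time_of_pos 0 x ht))
  refine h.congr_deriv ?_
  simp [heatKernel.eq_3, heatKernel.eq_2]
  field_simp
  ring

lemma continuous_heatKernel_time (n : ℕ) {x : ℝ} (hx : x ≠ 0) :
    Continuous fun s => heatKernel n x s :=
  continuous_iff_continuousAt.2 fun _ => (hasDerivAt_heatKernel_time n (Or.inl hx)).continuousAt

lemma continuous_heatKernel_space (n : ℕ) (t : ℝ) : Continuous fun y => heatKernel n y t :=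
  continuous_iff_continuousAt.2 fun y => (hasDerivAt_heatKernel_space n y t).continuousAt

lemma continuous_heatRamp_time {x : ℝ} (hx : 0 < x) : Continuous fun s => heatRamp x s := by
  unfold heatRamp
  have := continuous_heatStep_time hx
  have := continuous_heatKernel_time 0 hx.ne'
  fun_prop

lemma heatRamp_of_nonpos (x : ℝ) {t : ℝ} (ht : t ≤ 0) : heatRamp x t = 0 := by
  simp [heatRamp, heatStep_of_nonpos x ht, heatKernel_of_nonpos 0 x ht]

lemma continuousAt_heatRamp {p : ℝ × ℝ} (hp : p.2 ≠ 0) :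
    ContinuousAt (fun q : ℝ × ℝ => heatRamp q.1 q.2) p := by
  rcases lt_or_gt_of_ne hp with hp | hp
  · refine (continuousAt_const (y := (0 : ℝ))).congr ?_
    filter_upwards [continuousAt_snd.eventually_lt_const hp] with q hq
    exact (heatRamp_of_nonpos _ hq.le).symm
  · have h1 := continuousAt_heatStep hp
    have h2 := continuousAt_heatKernel 0 (p := p) (Or.inr hp.ne')
    unfold heatRamp
    fun_prop

lemma heatRamp_bound : ∃ C : ℝ, 0 ≤ C ∧ ∀ x t, |heatRamp x t| ≤ C * (|x| + √t) := by
  obtain ⟨C, hC, h⟩ := heatStep_bound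
  obtain ⟨D, hD, h'⟩ := heatKernel_bound 0 0
  refine ⟨C + 2 * D, by positivity, fun x t => ?_⟩
  rcases le_or_gt t 0 with ht | ht
  · rw [heatRamp_of_nonpos x ht, abs_zero]; positivity
  have hr := Real.sqrt_pos.2 ht
  have h1 : |x * heatStep x t| ≤ C * |x| := by
    rw [abs_mul, mul_comm]; exact mul_le_mul_of_nonneg_right (h x t) (abs_nonneg _)
  have h2 : |2 * t * heatKernel 0 x t| ≤ 2 * D * √t := by
    rw [abs_mul, abs_of_pos (show 0 < 2 * t by positivity)]
    have := h' x t ht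
    simp only [pow_zero, one_mul, zero_add, pow_one, mul_one] at this
    calc 2 * t * |heatKernel 0 x t| = 2 * √t * (|heatKernel 0 x t| * √t) := by
          nth_rw 1 [← Real.sq_sqrt ht.le]; ring
      _ ≤ 2 * √t * D := by gcongr
      _ = _ := by ring
  unfold heatRamp
  refine (abs_add_le _ _).trans ?_
  nlinarith [abs_nonneg x, mul_nonneg hC hr.le, mul_nonneg hD (abs_nonneg x)]

/-! ### Limits of heat potentials on their sources -/

/-- Integration by parts that moves a derivative from a convolution kernel to the density; the
kernel may fail to be differentiable at the origin. -/
lemma integral_kernel_deriv_smul {k k' : ℝ → ℝ} {f f' : ℝ → ℂ} {a b c : ℝ} (hk : Continuous k)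
    (hk' : Continuous k') (hkd : ∀ z ≠ 0, HasDerivAt k (k' z) z)
    (hf : ∀ y ∈ uIcc a b, HasDerivAt f (f' y) y) (hf' : ContinuousOn f' (uIcc a b)) :
    ∫ y in a..b, k' (c - y) • f y =
      k (c - a) • f a - k (c - b) • f b + ∫ y in a..b, k (c - y) • f' y := by
  have hfc : ContinuousOn f (uIcc a b) := fun y hy => (hf y hy).continuousAt.continuousWithinAt
  have i1 : IntervalIntegrable (fun y => k' (c - y) • f y) volume a b :=
    ContinuousOn.intervalIntegrable (by fun_prop)
  have i2 : IntervalIntegrable (fun y => k (c - y) • f' y) volume a b :=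
    ContinuousOn.intervalIntegrable (by fun_prop)
  have h := integral_eq_of_hasDerivAt_off_countable (fun y => k (c - y) • f y)
    (fun y => k (c - y) • f' y - k' (c - y) • f y) (countable_singleton c) (a := a) (b := b)
    (by fun_prop) (fun y hy => ?_) (i2.sub i1)
  · rw [intervalIntegral.integral_sub i2 i1] at h
    rw [← sub_eq_zero] at h ⊢
    rw [← neg_eq_zero, ← h]
    ring
  · have h1 : HasDerivAt (fun y => k (c - y)) (-k' (c - y)) y :=
      (hkd (c - y) (sub_ne_zero.2 (Ne.symm hy.2))).comp_const_sub c y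
    refine (h1.smul (hf y (Ioo_subset_Icc_self hy.1))).congr_deriv ?_
    simp [sub_eq_add_neg]

/-- The value of the potential with a smooth initial density, and of all its space derivatives,
at the time of the sources. -/
lemma tendsto_integral_heatKernel_initial {v : ℕ → ℝ → ℂ} {a b x₀ : ℝ} (ha : a < x₀) (hb : x₀ < b)
    (hv : ∀ j, ∀ y ∈ uIcc a b, HasDerivAt (v j) (v (j + 1) y) y) (n j : ℕ) :
    Tendsto (fun p : ℝ × ℝ => ∫ y in a..b, heatKernel n (p.1 - y) p.2 • v j y)
      (𝓝[{p | 0 < p.2}] (x₀, 0)) (𝓝 (v (j + n) x₀)) := by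
  have hvc : ∀ j, ContinuousOn (v j) (uIcc a b) := fun j y hy =>
    (hv j y hy).continuousAt.continuousWithinAt
  have hab : a ≤ b := (ha.trans hb).le
  have hshift : ∀ c : ℝ, Tendsto (fun p : ℝ × ℝ => (p.1 - c, p.2)) (𝓝[{p | 0 < p.2}] (x₀, 0))
      (𝓝[{p | 0 < p.2}] (x₀ - c, 0)) := by
    intro c
    refine tendsto_nhdsWithin_iff.2 ⟨?_, self_mem_nhdsWithin⟩
    have : ContinuousAt (fun p : ℝ × ℝ => (p.1 - c, p.2)) (x₀, 0) := by fun_prop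
    exact this.mono_left nhdsWithin_le_nhds
  have hpos : ∀ c, c < x₀ → Tendsto (fun p : ℝ × ℝ => heatStep (p.1 - c) p.2)
      (𝓝[{p | 0 < p.2}] (x₀, 0)) (𝓝 0) := fun c hc =>
    (tendsto_heatStep_initial_of_pos (sub_pos.2 hc)).comp (hshift c)
  have hneg : ∀ c, x₀ < c → Tendsto (fun p : ℝ × ℝ => heatStep (p.1 - c) p.2)
      (𝓝[{p | 0 < p.2}] (x₀, 0)) (𝓝 (-1)) := fun c hc =>
    (tendsto_heatStep_initial_of_neg (sub_neg.2 hc)).comp (hshift c)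
  have hker : ∀ n c, c ≠ x₀ → Tendsto (fun p : ℝ × ℝ => heatKernel n (p.1 - c) p.2)
      (𝓝[{p | 0 < p.2}] (x₀, 0)) (𝓝 0) := by
    intro n c hc
    have h := continuousAt_heatKernel n (p := (x₀ - c, 0)) (Or.inl (sub_ne_zero.2 hc.symm))
    rw [ContinuousAt, heatKernel_of_nonpos n _ le_rfl] at h
    exact (h.mono_left nhdsWithin_le_nhds).comp (hshift c)
  induction n generalizing j with
  | zero =>
    -- the limit of the primitive is a step function, whose pairing with `v'` is elementary
    obtain ⟨C, hC, hb'⟩ := heatStep_bound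
    have hlim : Tendsto (fun p : ℝ × ℝ => ∫ y in a..b, heatStep (p.1 - y) p.2 • v (j + 1) y)
        (𝓝[{p | 0 < p.2}] (x₀, 0))
        (𝓝 (∫ y in a..b, (if y < x₀ then (0 : ℝ) else -1) • v (j + 1) y)) := by
      refine intervalIntegral.tendsto_integral_filter_of_dominated_convergence
        (fun y => C * ‖v (j + 1) y‖) ?_ ?_ ?_ ?_
      · filter_upwards [self_mem_nhdsWithin] with p hp
        have h1 : Continuous fun y => heatStep (p.1 - y) p.2 := by
          have : Continuous fun z => heatStep z p.2 := continuous_iff_continuousAt.2 fun z =>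
            (hasDerivAt_heatStep_space z hp).continuousAt
          fun_prop
        exact ((h1.continuousOn.smul (hvc (j + 1))).mono uIoc_subset_uIcc).aestronglyMeasurable
          measurableSet_uIoc
      · filter_upwards with p
        filter_upwards with y _
        rw [norm_smul]
        exact mul_le_mul_of_nonneg_right (hb' _ _) (norm_nonneg _)
      · exact ContinuousOn.intervalIntegrable (continuousOn_const.mul (hvc (j + 1)).norm)
      · have : ∀ᵐ y : ℝ, y ≠ x₀ := by simp [ae_iff]
        filter_upwards [this] with y hy _
        refine Tendsto.smul ?_ tendsto_const_nhds
        split_ifs with h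
        · exact hpos y h
        · exact hneg y (lt_of_le_of_ne (not_lt.1 h) hy.symm)
    have hval : ∫ y in a..b, (if y < x₀ then (0 : ℝ) else -1) • v (j + 1) y = v j x₀ - v j b := by
      have s1 : uIcc a x₀ ⊆ uIcc a b := by
        rw [uIcc_of_le ha.le, uIcc_of_le hab]; exact Icc_subset_Icc_right hb.le
      have s2 : uIcc x₀ b ⊆ uIcc a b := by
        rw [uIcc_of_le hb.le, uIcc_of_le hab]; exact Icc_subset_Icc_left ha.le
      have e1 : ∀ᵐ y : ℝ, y ∈ uIoc a x₀ →
          (0 : ℂ) = (if y < x₀ then (0 : ℝ) else -1) • v (j + 1) y := by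
        have : ∀ᵐ y : ℝ, y ≠ x₀ := by simp [ae_iff]
        filter_upwards [this] with y hy hy'
        rw [uIoc_of_le ha.le] at hy'
        rw [if_pos (lt_of_le_of_ne hy'.2 hy), zero_smul]
      have e2 : ∀ᵐ y : ℝ, y ∈ uIoc x₀ b →
          -v (j + 1) y = (if y < x₀ then (0 : ℝ) else -1) • v (j + 1) y := by
        filter_upwards with y hy'
        rw [uIoc_of_le hb.le] at hy'
        rw [if_neg hy'.1.not_gt, neg_smul, one_smul]
      have i2 : IntervalIntegrable (v (j + 1)) volume x₀ b :=
        ((hvc (j + 1)).mono s2).intervalIntegrable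
      rw [← intervalIntegral.integral_add_adjacent_intervals (b := x₀)
        ((intervalIntegrable_const (c := (0 : ℂ))).congr_ae
          ((ae_restrict_iff' measurableSet_uIoc).2 e1))
        (i2.neg.congr_ae ((ae_restrict_iff' measurableSet_uIoc).2 e2)),
        ← intervalIntegral.integral_congr_ae e1, ← intervalIntegral.integral_congr_ae e2,
        intervalIntegral.integral_neg,
        intervalIntegral.integral_eq_sub_of_hasDerivAt (fun y hy => hv j y (s2 hy)) i2]
      simp
    have h := (((hpos a ha).smul (tendsto_const_nhds (x := v j a))).sub
      ((hneg b hb).smul (tendsto_const_nhds (x := v j b)))).add hlim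
    rw [hval] at h
    have e : (0 : ℝ) • v j a - (-1 : ℝ) • v j b + (v j x₀ - v j b) = v (j + 0) x₀ := by simp
    rw [e] at h
    refine h.congr' ?_
    filter_upwards [self_mem_nhdsWithin] with p hp
    exact (integral_kernel_deriv_smul (k := fun z => heatStep z p.2)
      (k' := fun z => heatKernel 0 z p.2)
      (continuous_iff_continuousAt.2 fun z => (hasDerivAt_heatStep_space z hp).continuousAt)
      (continuous_heatKernel_space 0 p.2) (fun z _ => hasDerivAt_heatStep_space z hp) (hv j)
      (hvc (j + 1))).symm
  | succ n ih =>
    have h := (((hker n a ha.ne).smul (tendsto_const_nhds (x := v j a))).sub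
      ((hker n b hb.ne').smul (tendsto_const_nhds (x := v j b)))).add (ih (j + 1))
    rw [zero_smul, zero_smul, sub_self, zero_add, show j + 1 + n = j + (n + 1) by ring] at h
    refine h.congr fun p => ?_
    exact (integral_kernel_deriv_smul (k := fun z => heatKernel n z p.2)
      (k' := fun z => heatKernel (n + 1) z p.2) (continuous_heatKernel_space n p.2)
      (continuous_heatKernel_space (n + 1) p.2)
      (fun z _ => hasDerivAt_heatKernel_space n z p.2) (hv j) (hvc (j + 1))).symm

/-- The normal derivatives of the potential with a smooth boundary density have limits on the
boundary; the first one jumps by half the density. -/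
lemma tendsto_integral_heatKernel_boundary {v : ℕ → ℝ → ℂ} {a b t₀ : ℝ} (ha : a < t₀) (hb : t₀ < b)
    (hv : ∀ j, ∀ y ∈ uIcc a b, HasDerivAt (v j) (v (j + 1) y) y) (n j : ℕ) :
    ∃ L : ℂ, Tendsto (fun p : ℝ × ℝ => ∫ τ in a..b, heatKernel n p.1 (p.2 - τ) • v j τ)
      (𝓝[{p | 0 < p.1}] (0, t₀)) (𝓝 L) ∧ (n = 1 → L = -(1 / 2) * v j t₀) := by
  have hvc : ∀ j, ContinuousOn (v j) (uIcc a b) := fun j y hy =>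
    (hv j y hy).continuousAt.continuousWithinAt
  have hab : a ≤ b := (ha.trans hb).le
  have hshift : ∀ c : ℝ, Tendsto (fun p : ℝ × ℝ => (p.1, p.2 - c)) (𝓝[{p | 0 < p.1}] (0, t₀))
      (𝓝 (0, t₀ - c)) := by
    intro c
    have : ContinuousAt (fun p : ℝ × ℝ => (p.1, p.2 - c)) (0, t₀) := by fun_prop
    exact this.mono_left nhdsWithin_le_nhds
  have hstep : ∀ c, c ≠ t₀ → Tendsto (fun p : ℝ × ℝ => heatStep p.1 (p.2 - c))
      (𝓝[{p | 0 < p.1}] (0, t₀)) (𝓝 (if c < t₀ then -(1 / 2) else 0)) := by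
    intro c hc
    split_ifs with h
    · rw [← heatStep_zero (sub_pos.2 h)]
      exact (continuousAt_heatStep (p := (0, t₀ - c)) (sub_pos.2 h)).tendsto.comp (hshift c)
    · have h' : t₀ < c := lt_of_le_of_ne (not_lt.1 h) hc.symm
      refine tendsto_const_nhds.congr' ?_
      have : ∀ᶠ p : ℝ × ℝ in 𝓝[{p | 0 < p.1}] (0, t₀), p.2 < c :=
        nhdsWithin_le_nhds (continuousAt_snd.eventually_lt_const h')
      filter_upwards [this] with p hp
      exact (heatStep_of_nonpos _ (sub_nonpos.2 hp.le)).symm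
  have hramp : ∀ c, c ≠ t₀ → Tendsto (fun p : ℝ × ℝ => heatRamp p.1 (p.2 - c))
      (𝓝[{p | 0 < p.1}] (0, t₀)) (𝓝 (heatRamp 0 (t₀ - c))) := fun c hc =>
    (continuousAt_heatRamp (p := (0, t₀ - c)) (sub_ne_zero.2 hc.symm)).tendsto.comp (hshift c)
  have hker : ∀ n c, c ≠ t₀ → Tendsto (fun p : ℝ × ℝ => heatKernel n p.1 (p.2 - c))
      (𝓝[{p | 0 < p.1}] (0, t₀)) (𝓝 (heatKernel n 0 (t₀ - c))) := fun n c hc =>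
    (continuousAt_heatKernel n (p := (0, t₀ - c)) (Or.inr (sub_ne_zero.2 hc.symm))).tendsto.comp
      (hshift c)
  have hae : ∀ᵐ y : ℝ, y ≠ t₀ := by simp [ae_iff]
  induction n using Nat.twoStepInduction generalizing j with
  | zero =>
    obtain ⟨C, hC, hb'⟩ := heatRamp_bound
    have hlim : Tendsto (fun p : ℝ × ℝ => ∫ y in a..b, heatRamp p.1 (p.2 - y) • v (j + 1) y)
        (𝓝[{p | 0 < p.1}] (0, t₀)) (𝓝 (∫ y in a..b, heatRamp 0 (t₀ - y) • v (j + 1) y)) := by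
      refine intervalIntegral.tendsto_integral_filter_of_dominated_convergence
        (fun y => C * (1 + √(t₀ + 1 - a)) * ‖v (j + 1) y‖) ?_ ?_ ?_ ?_
      · filter_upwards [self_mem_nhdsWithin] with p hp
        have h1 : Continuous fun y => heatRamp p.1 (p.2 - y) := by
          have := continuous_heatRamp_time hp
          fun_prop
        exact ((h1.continuousOn.smul (hvc (j + 1))).mono uIoc_subset_uIcc).aestronglyMeasurable
          measurableSet_uIoc
      · have h1 : ∀ᶠ p : ℝ × ℝ in 𝓝[{p | 0 < p.1}] (0, t₀), |p.1| < 1 :=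
          nhdsWithin_le_nhds (continuousAt_fst.abs.eventually_lt_const (by simp))
        have h2 : ∀ᶠ p : ℝ × ℝ in 𝓝[{p | 0 < p.1}] (0, t₀), p.2 < t₀ + 1 :=
          nhdsWithin_le_nhds (continuousAt_snd.eventually_lt_const (by simp))
        filter_upwards [h1, h2] with p hp1 hp2
        filter_upwards with y hy
        rw [uIoc_of_le hab] at hy
        rw [norm_smul]
        refine mul_le_mul_of_nonneg_right ((hb' _ _).trans ?_) (norm_nonneg _)
        gcongr
        linarith [hy.1]
      · exact ContinuousOn.intervalIntegrable (continuousOn_const.mul (hvc (j + 1)).norm)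
      · filter_upwards [hae] with y hy _ using (hramp y hy).smul tendsto_const_nhds
    refine ⟨_, ((((hramp a ha.ne).smul (tendsto_const_nhds (x := v j a))).sub
      ((hramp b hb.ne').smul (tendsto_const_nhds (x := v j b)))).add hlim).congr' ?_, by simp⟩
    filter_upwards [self_mem_nhdsWithin] with p hp
    refine (integral_kernel_deriv_smul (k := fun z => heatRamp p.1 z)
      (k' := fun z => heatKernel 0 p.1 z) (continuous_heatRamp_time hp)
      (continuous_heatKernel_time 0 (ne_of_gt hp)) (fun z hz => ?_) (hv j) (hvc (j + 1))).symm
    rcases lt_or_gt_of_ne hz with hz | hz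
    · rw [heatKernel_of_nonpos _ _ hz.le]
      refine (hasDerivAt_const z (0 : ℝ)).congr_of_eventuallyEq ?_
      filter_upwards [gt_mem_nhds hz] with s hs using heatRamp_of_nonpos _ (le_of_lt hs)
    · exact hasDerivAt_heatRamp_time _ hz
  | one =>
    obtain ⟨C, hC, hb'⟩ := heatStep_bound
    have hlim : Tendsto (fun p : ℝ × ℝ => ∫ y in a..b, heatStep p.1 (p.2 - y) • v (j + 1) y)
        (𝓝[{p | 0 < p.1}] (0, t₀))
        (𝓝 (∫ y in a..b, (if y < t₀ then (-(1 / 2) : ℝ) else 0) • v (j + 1) y)) := by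
      refine intervalIntegral.tendsto_integral_filter_of_dominated_convergence
        (fun y => C * ‖v (j + 1) y‖) ?_ ?_ ?_ ?_
      · filter_upwards [self_mem_nhdsWithin] with p hp
        have h1 : Continuous fun y => heatStep p.1 (p.2 - y) := by
          have := continuous_heatStep_time hp
          fun_prop
        exact ((h1.continuousOn.smul (hvc (j + 1))).mono uIoc_subset_uIcc).aestronglyMeasurable
          measurableSet_uIoc
      · filter_upwards with p
        filter_upwards with y _
        rw [norm_smul]
        exact mul_le_mul_of_nonneg_right (hb' _ _) (norm_nonneg _)
      · exact ContinuousOn.intervalIntegrable (continuousOn_const.mul (hvc (j + 1)).norm)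
      · filter_upwards [hae] with y hy _ using (hstep y hy).smul tendsto_const_nhds
    have hval : ∫ y in a..b, (if y < t₀ then (-(1 / 2) : ℝ) else 0) • v (j + 1) y =
        -(1 / 2) * (v j t₀ - v j a) := by
      have s1 : uIcc a t₀ ⊆ uIcc a b := by
        rw [uIcc_of_le ha.le, uIcc_of_le hab]; exact Icc_subset_Icc_right hb.le
      have e1 : ∀ᵐ y : ℝ, y ∈ uIoc a t₀ →
          -(1 / 2) * v (j + 1) y = (if y < t₀ then (-(1 / 2) : ℝ) else 0) • v (j + 1) y := by
        filter_upwards [hae] with y hy hy'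
        rw [uIoc_of_le ha.le] at hy'
        rw [if_pos (lt_of_le_of_ne hy'.2 hy)]
        simp
      have e2 : ∀ᵐ y : ℝ, y ∈ uIoc t₀ b →
          (0 : ℂ) = (if y < t₀ then (-(1 / 2) : ℝ) else 0) • v (j + 1) y := by
        filter_upwards with y hy'
        rw [uIoc_of_le hb.le] at hy'
        rw [if_neg hy'.1.not_gt, zero_smul]
      have i1 : IntervalIntegrable (v (j + 1)) volume a t₀ :=
        ((hvc (j + 1)).mono s1).intervalIntegrable
      rw [← intervalIntegral.integral_add_adjacent_intervals (b := t₀)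
        ((i1.const_mul _).congr_ae ((ae_restrict_iff' measurableSet_uIoc).2 e1))
        ((intervalIntegrable_const (c := (0 : ℂ))).congr_ae
          ((ae_restrict_iff' measurableSet_uIoc).2 e2)),
        ← intervalIntegral.integral_congr_ae e1, ← intervalIntegral.integral_congr_ae e2,
        intervalIntegral.integral_const_mul,
        intervalIntegral.integral_eq_sub_of_hasDerivAt (fun y hy => hv j y (s1 hy)) i1]
      simp
    have h := (((hstep a ha.ne).smul (tendsto_const_nhds (x := v j a))).sub
      ((hstep b hb.ne').smul (tendsto_const_nhds (x := v j b)))).add hlim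
    rw [hval, if_pos ha, if_neg hb.not_gt] at h
    have e : (-(1 / 2) : ℝ) • v j a - (0 : ℝ) • v j b + -(1 / 2) * (v j t₀ - v j a) =
        -(1 / 2) * v j t₀ := by
      simp
      ring
    rw [e] at h
    refine ⟨_, h.congr' ?_, fun _ => rfl⟩
    filter_upwards [self_mem_nhdsWithin] with p hp
    refine (integral_kernel_deriv_smul (k := fun z => heatStep p.1 z)
      (k' := fun z => heatKernel 1 p.1 z) (continuous_heatStep_time hp)
      (continuous_heatKernel_time 1 (ne_of_gt hp)) (fun z hz => ?_) (hv j) (hvc (j + 1))).symm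
    rcases lt_or_gt_of_ne hz with hz | hz
    · rw [heatKernel_of_nonpos _ _ hz.le]
      refine (hasDerivAt_const z (0 : ℝ)).congr_of_eventuallyEq ?_
      filter_upwards [gt_mem_nhds hz] with s hs using heatStep_of_nonpos _ (le_of_lt hs)
    · exact hasDerivAt_heatStep_time _ hz
  | more n ih _ =>
    obtain ⟨L, hL, -⟩ := ih (j + 1)
    refine ⟨_, ((((hker n a ha.ne).smul (tendsto_const_nhds (x := v j a))).sub
      ((hker n b hb.ne').smul (tendsto_const_nhds (x := v j b)))).add hL).congr' ?_, by simp⟩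
    filter_upwards [self_mem_nhdsWithin] with p hp
    have hp' : p.1 ≠ 0 := ne_of_gt hp
    exact (integral_kernel_deriv_smul (k := fun z => heatKernel n p.1 z)
      (k' := fun z => heatKernel (n + 2) p.1 z) (continuous_heatKernel_time n hp')
      (continuous_heatKernel_time (n + 2) hp')
      (fun z _ => hasDerivAt_heatKernel_time n (Or.inl hp')) (hv j) (hvc (j + 1))).symm

/-! ### Hierarchies of derivatives -/

lemma iteratedDeriv_eq_of_hasDerivAt {φ : ℝ → ℂ} {f : ℕ → ℝ → ℂ} (h0 : ∀ x, 0 < x → φ x = f 0 x)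
    (hf : ∀ n x, 0 < x → HasDerivAt (f n) (f (n + 1) x) x) (n : ℕ) {x : ℝ} (hx : 0 < x) :
    iteratedDeriv n φ x = f n x := by
  induction n generalizing x with
  | zero => simpa using h0 x hx
  | succ n ih =>
    have e : iteratedDeriv n φ =ᶠ[𝓝 x] f n := by
      filter_upwards [lt_mem_nhds hx] with y hy using ih hy
    rw [iteratedDeriv_succ, e.deriv_eq, (hf n x hx).deriv]

lemma contDiffOn_of_hasDerivAt {f : ℕ → ℝ → ℂ}
    (hf : ∀ n x, 0 < x → HasDerivAt (f n) (f (n + 1) x) x) (n : ℕ) :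
    ContDiffOn ℝ ∞ (f n) (Ioi 0) := by
  refine contDiffOn_infty.2 fun k => ?_
  induction k generalizing n with
  | zero =>
    exact contDiffOn_zero.2 fun x hx => (hf n x hx).continuousAt.continuousWithinAt
  | succ k ih =>
    rw [Nat.cast_succ, contDiffOn_succ_iff_deriv_of_isOpen isOpen_Ioi]
    refine ⟨fun x hx => (hf n x hx).differentiableAt.differentiableWithinAt, by simp, ?_⟩
    exact (ih (n + 1)).congr fun x hx => (hf n x hx).deriv

lemma smoothHalfLine_of_hasDerivAt {φ : ℝ → ℂ} {f : ℕ → ℝ → ℂ} (h0 : ∀ x, 0 < x → φ x = f 0 x)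
    (hf : ∀ n x, 0 < x → HasDerivAt (f n) (f (n + 1) x) x)
    (hlim : ∀ n, ∃ L, Tendsto (f n) (𝓝[>] 0) (𝓝 L)) : SmoothHalfLine φ := by
  refine ⟨(contDiffOn_of_hasDerivAt hf 0).congr h0, fun n => ?_⟩
  obtain ⟨L, hL⟩ := hlim n
  refine ⟨L, hL.congr' ?_⟩
  filter_upwards [self_mem_nhdsWithin] with x hx
  exact (iteratedDeriv_eq_of_hasDerivAt h0 hf n hx).symm

lemma ContDiffOn.hasDerivAt_iteratedDeriv {f : ℝ → ℂ} (hf : ContDiffOn ℝ ∞ f (Ioi 0)) (n : ℕ)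
    {x : ℝ} (hx : 0 < x) : HasDerivAt (iteratedDeriv n f) (iteratedDeriv (n + 1) f x) x := by
  rw [iteratedDeriv_succ]
  have h : ∀ n : ℕ, ContDiffOn ℝ ∞ (iteratedDeriv n f) (Ioi 0) := by
    intro n
    induction n with
    | zero => simpa using hf
    | succ n ih =>
      rw [iteratedDeriv_succ]
      exact ((contDiffOn_infty_iff_deriv_of_isOpen isOpen_Ioi).1 ih).2
  exact (((contDiffOn_infty_iff_deriv_of_isOpen isOpen_Ioi).1 (h n)).1.differentiableAt
    (Ioi_mem_nhds hx)).hasDerivAt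

lemma isOpen_openQuadrant : IsOpen openQuadrant :=
  (isOpen_lt continuous_const continuous_fst).inter (isOpen_lt continuous_const continuous_snd)

/-- A sequence of continuous functions on the quadrant in which `F (n + 1)` is the `x`-derivative
and `F (n + 2)` the `t`-derivative of `F n`: the space derivatives of a solution of the heat
equation. -/
structure IsHeatHierarchy (F : ℕ → ℝ → ℝ → ℂ) : Prop where
  space : ∀ n x t, 0 < x → 0 < t → HasDerivAt (fun y => F n y t) (F (n + 1) x t) x
  time : ∀ n x t, 0 < x → 0 < t → HasDerivAt (fun s => F n x s) (F (n + 2) x t) t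
  cont : ∀ n, ∀ p ∈ openQuadrant, ContinuousAt (fun q : ℝ × ℝ => F n q.1 q.2) p

namespace IsHeatHierarchy

variable {F : ℕ → ℝ → ℝ → ℂ}

lemma hasFDerivAt (hF : IsHeatHierarchy F) (n : ℕ) {p : ℝ × ℝ} (hp : p ∈ openQuadrant) :
    HasFDerivAt (fun q : ℝ × ℝ => F n q.1 q.2)
      ((ContinuousLinearMap.toSpanSingleton ℝ (F (n + 1) p.1 p.2)).coprod
        (ContinuousLinearMap.toSpanSingleton ℝ (F (n + 2) p.1 p.2))) p := by
  have hnear : ∀ᶠ q : ℝ × ℝ in 𝓝 p, q ∈ openQuadrant := isOpen_openQuadrant.mem_nhds hp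
  have hL : Continuous fun z : ℂ => ContinuousLinearMap.toSpanSingleton ℝ z :=
    (ContinuousLinearMap.toSpanSingletonLE ℝ ℝ ℂ).toContinuousLinearMap.continuous
  exact (hasStrictFDerivAt_uncurry_coprod (f := F n)
    (f₁ := fun x t => ContinuousLinearMap.toSpanSingleton ℝ (F (n + 1) x t))
    (f₂ := fun x t => ContinuousLinearMap.toSpanSingleton ℝ (F (n + 2) x t))
    (hnear.mono fun q hq => (hF.space n q.1 q.2 hq.1 hq.2).hasFDerivAt)
    (hnear.mono fun q hq => (hF.time n q.1 q.2 hq.1 hq.2).hasFDerivAt)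
    (hL.continuousAt.comp (hF.cont (n + 1) p hp))
    (hL.continuousAt.comp (hF.cont (n + 2) p hp))).hasFDerivAt

lemma contDiffOn (hF : IsHeatHierarchy F) (n : ℕ) :
    ContDiffOn ℝ ∞ (fun q : ℝ × ℝ => F n q.1 q.2) openQuadrant := by
  refine contDiffOn_infty.2 fun k => ?_
  induction k generalizing n with
  | zero => exact contDiffOn_zero.2 fun p hp => (hF.cont n p hp).continuousWithinAt
  | succ k ih =>
    rw [Nat.cast_succ, contDiffOn_succ_iff_fderiv_of_isOpen isOpen_openQuadrant]
    refine ⟨fun p hp => (hF.hasFDerivAt n hp).differentiableAt.differentiableWithinAt, by simp, ?_⟩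
    refine ContDiffOn.congr ?_ fun p hp => (hF.hasFDerivAt n hp).fderiv
    rw [contDiffOn_clm_apply]
    intro v
    simp only [ContinuousLinearMap.coprod_apply, ContinuousLinearMap.toSpanSingleton_apply]
    exact (contDiffOn_const.smul (ih (n + 1))).add (contDiffOn_const.smul (ih (n + 2)))

lemma time_iterate (hF : IsHeatHierarchy F) {x : ℝ} (hx : 0 < x) (n : ℕ) (t : ℝ) (ht : 0 < t) :
    HasDerivAt (F (2 * n) x) (F (2 * (n + 1)) x t) t := hF.time (2 * n) x t hx ht

end IsHeatHierarchy

/-- Differentiation along the boundary commutes with the passage to boundary values, when the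
latter exist as limits in the interior variable `s` and the boundary variable `y` jointly. -/
lemma hasDerivAt_trace {f f' : ℝ → ℝ → ℂ} {g g' : ℝ → ℂ}
    (hf : ∀ s y, 0 < s → 0 < y → HasDerivAt (f s) (f' s y) y)
    (hg : ∀ y, 0 < y → Tendsto (fun p : ℝ × ℝ => f p.1 p.2) (𝓝[>] 0 ×ˢ 𝓝 y) (𝓝 (g y)))
    (hg' : ∀ y, 0 < y → Tendsto (fun p : ℝ × ℝ => f' p.1 p.2) (𝓝[>] 0 ×ˢ 𝓝 y) (𝓝 (g' y)))
    {y : ℝ} (hy : 0 < y) : HasDerivAt g (g' y) y := by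
  have hslice : ∀ {h : ℝ → ℝ → ℂ} {k : ℝ → ℂ},
      (∀ y, 0 < y → Tendsto (fun p : ℝ × ℝ => h p.1 p.2) (𝓝[>] 0 ×ˢ 𝓝 y) (𝓝 (k y))) →
      ∀ y, 0 < y → Tendsto (fun s => h s y) (𝓝[>] 0) (𝓝 (k y)) := fun hk y hy =>
    (hk y hy).comp (tendsto_id.prodMk (tendsto_const_nhds (x := y)))
  -- a joint limit is continuous in the boundary variable
  have hcont : ∀ y, 0 < y → ContinuousAt g' y := by
    intro y hy
    rw [ContinuousAt, Metric.tendsto_nhds]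
    intro ε hε
    obtain ⟨P, hP, R, hR, hPR⟩ := eventually_prod_iff.1
      ((hg' y hy).eventually (Metric.closedBall_mem_nhds _ (half_pos hε)))
    filter_upwards [hR, lt_mem_nhds hy] with z hz hz0
    have : dist (g' z) (g' y) ≤ ε / 2 :=
      le_of_tendsto ((hslice hg' z hz0).dist tendsto_const_nhds) (hP.mono fun s hs => hPR hs hz)
    linarith
  refine hasDerivAt_of_tendstoLocallyUniformlyOn (l := 𝓝[>] (0 : ℝ)) (f := f) (f' := f')
    isOpen_Ioi ?_ ?_ (fun y hy => hslice hg y hy) hy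
  · rw [isOpen_Ioi.tendstoLocallyUniformlyOn_iff_forall_tendsto]
    intro z hz
    have h1 : Tendsto (fun p : ℝ × ℝ => g' p.2) (𝓝[>] 0 ×ˢ 𝓝 z) (𝓝 (g' z)) :=
      (hcont z hz).tendsto.comp tendsto_snd
    exact (h1.prodMk_nhds (hg' z hz)).mono_right (nhds_le_uniformity _)
  · filter_upwards [self_mem_nhdsWithin] with s hs y hy using hf s y hs hy

/-! ### The Dirichlet problem in physical space -/

/-- The `n`-th space derivative of the solution of the heat equation on the half-line with initial
value `u₀` and boundary value `g₀`, by the method of images: the initial datum is reflected oddly,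
and the boundary datum is the density of a double layer `-2 ∂ₓK`. -/
noncomputable def dirichletSolution (u₀ g₀ : ℝ → ℂ) (n : ℕ) (x t : ℝ) : ℂ :=
  heatPotential n (Ioi 0) (fun y => y) (fun _ => 0) u₀ x t
    - heatPotential n (Ioi 0) (fun y => -y) (fun _ => 0) u₀ x t
    - 2 * heatPotential (n + 1) (Ioc 0 t) (fun _ => 0) (fun τ => τ) g₀ x t

/-- By causality, the boundary data after time `t` do not matter at time `t`. -/
lemma heatPotential_boundary_eq (n : ℕ) (g₀ : ℝ → ℂ) (x : ℝ) {t T : ℝ} (hT : t ≤ T) :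
    heatPotential n (Ioc 0 t) (fun _ => 0) (fun τ => τ) g₀ x t =
      heatPotential n (Ioc 0 T) (fun _ => 0) (fun τ => τ) g₀ x t := by
  refine (setIntegral_eq_of_subset_of_forall_sdiff_eq_zero measurableSet_Ioc
    (Ioc_subset_Ioc_right hT) fun τ hτ => ?_).symm
  have h : t - τ ≤ 0 := by
    by_contra! hc
    exact hτ.2 ⟨hτ.1.1, by linarith⟩
  rw [heatKernel_of_nonpos _ _ h, zero_smul]

lemma farFromSources_initial (S : Set ℝ) (ξ : ℝ → ℝ) (x t : ℝ) :
    FarFromSources t S ξ (fun _ => 0) x t := fun a _ => Or.inr (by simp)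

lemma farFromSources_reflected {x : ℝ} (hx : 0 < x) (t : ℝ) :
    FarFromSources x (Ioi 0) (fun y => -y) (fun _ => 0) x t := fun a ha => by
  left
  have ha' : 0 < a := ha
  rw [abs_of_pos] <;> linarith

lemma farFromSources_boundary {x : ℝ} (hx : 0 < x) (S : Set ℝ) (τ : ℝ → ℝ) (t : ℝ) :
    FarFromSources x S (fun _ => 0) τ x t := fun a _ => by
  left
  rw [sub_zero, abs_of_pos hx]

section Dirichlet

variable {u₀ g₀ : ℝ → ℂ}

lemma isHeatHierarchy_dirichletSolution (hu : IntegrableOn u₀ (Ioi 0))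
    (hg : ∀ T, IntegrableOn g₀ (Ioc 0 T)) : IsHeatHierarchy (dirichletSolution u₀ g₀) := by
  constructor
  · intro n x t hx ht
    exact ((hasDerivAt_heatPotential_space n measurableSet_Ioi measurable_id measurable_const hu ht
      (farFromSources_initial _ _ x t)).sub (hasDerivAt_heatPotential_space n measurableSet_Ioi
      measurable_neg measurable_const hu ht (farFromSources_initial _ _ x t))).sub
      ((hasDerivAt_heatPotential_space (n + 1) measurableSet_Ioc measurable_const measurable_id
        (hg t) hx (farFromSources_boundary hx _ _ t)).const_mul 2)
  · intro n x t hx ht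
    have h := ((hasDerivAt_heatPotential_time n measurableSet_Ioi measurable_id measurable_const hu
      ht (farFromSources_initial _ _ x t)).sub (hasDerivAt_heatPotential_time n measurableSet_Ioi
      measurable_neg measurable_const hu ht (farFromSources_initial _ _ x t))).sub
      ((hasDerivAt_heatPotential_time (n + 1) measurableSet_Ioc measurable_const measurable_id
        (hg (t + 1)) hx (farFromSources_boundary hx _ _ t)).const_mul 2)
    refine (h.congr_of_eventuallyEq ?_).congr_deriv ?_
    · filter_upwards [gt_mem_nhds (lt_add_one t)] with s hs
      rw [dirichletSolution, heatPotential_boundary_eq _ _ _ (le_of_lt hs)]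
      rfl
    · rw [dirichletSolution, heatPotential_boundary_eq _ _ _ (lt_add_one t).le]
      rfl
  · intro n p hp
    have h := ((continuousAt_heatPotential n measurableSet_Ioi measurable_id measurable_const hu
      hp.2 (farFromSources_initial _ _ p.1 p.2)).sub (continuousAt_heatPotential n
      measurableSet_Ioi measurable_neg measurable_const hu hp.2
      (farFromSources_initial _ _ p.1 p.2))).sub
      ((continuousAt_heatPotential (n + 1) measurableSet_Ioc measurable_const measurable_id
        (hg (p.2 + 1)) hp.1 (farFromSources_boundary hp.1 _ _ p.2)).const_mul 2)
    refine h.congr ?_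
    filter_upwards [continuousAt_snd.eventually_lt_const (lt_add_one p.2)] with q hq
    rw [dirichletSolution, heatPotential_boundary_eq _ _ _ (le_of_lt hq)]
    rfl

/-- The space derivatives of the solution tend to those of the initial datum as `t → 0⁺`. -/
lemma tendsto_dirichletSolution_initial (hu : IntegrableOn u₀ (Ioi 0))
    (hud : ContDiffOn ℝ ∞ u₀ (Ioi 0)) (hg : ∀ T, IntegrableOn g₀ (Ioc 0 T)) (n : ℕ) {x : ℝ}
    (hx : 0 < x) :
    Tendsto (fun t => dirichletSolution u₀ g₀ n x t) (𝓝[>] 0) (𝓝 (iteratedDeriv n u₀ x)) := by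
  have hline : Tendsto (fun t : ℝ => (x, t)) (𝓝[>] 0) (𝓝[{p | 0 < p.2}] (x, 0)) := by
    refine tendsto_nhdsWithin_iff.2 ⟨?_, ?_⟩
    · have : ContinuousAt (fun s : ℝ => (x, s)) 0 := by fun_prop
      exact this.mono_left nhdsWithin_le_nhds
    · filter_upwards [self_mem_nhdsWithin] with s hs using hs
  -- a potential whose sources keep away from `x` vanishes at time zero
  have hfar : ∀ {m : ℕ} {S : Set ℝ} {ξ τ : ℝ → ℝ} {w : ℝ → ℂ} {δ : ℝ}, MeasurableSet S →
      Measurable ξ → Measurable τ → IntegrableOn w S → 0 < δ → FarFromSources δ S ξ τ x 0 →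
      (∀ a ∈ S, 0 ≤ τ a) →
      Tendsto (fun t => heatPotential m S ξ τ w x t) (𝓝[>] 0) (𝓝 0) := by
    intro m S ξ τ w δ hS hξ hτ hw hδ h hn
    have h0 : heatPotential m S ξ τ w x 0 = 0 := by
      refine setIntegral_eq_zero_of_forall_eq_zero fun a ha => ?_
      rw [heatKernel_of_nonpos _ _ (by simpa using hn a ha), zero_smul]
    have := continuousAt_heatPotential m hS hξ hτ hw hδ (p := (x, 0)) h
    rw [ContinuousAt, h0] at this
    exact (this.mono_left nhdsWithin_le_nhds).comp hline
  have hx2 := half_pos hx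
  have hu1 : IntegrableOn u₀ (Ioc 0 (x / 2)) := hu.mono_set Ioc_subset_Ioi_self
  have hu2 : IntegrableOn u₀ (Ioc (x / 2) (2 * x)) :=
    hu.mono_set fun y hy => hx2.trans hy.1
  have hu3 : IntegrableOn u₀ (Ioi (2 * x)) := hu.mono_set (Ioi_subset_Ioi (by linarith))
  have h1 := hfar (m := n) (ξ := fun y => y) (τ := fun _ => 0) measurableSet_Ioc measurable_id
    measurable_const hu1 hx2 (fun a ha => Or.inl (by rw [abs_of_pos] <;> linarith [ha.2]))
    (fun _ _ => le_rfl)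
  have h3 := hfar (m := n) (ξ := fun y => y) (τ := fun _ => 0) measurableSet_Ioi measurable_id
    measurable_const hu3 hx (fun a ha => Or.inl (by
      have ha' : 2 * x < a := ha
      rw [abs_of_neg] <;> linarith)) (fun _ _ => le_rfl)
  have h4 := hfar (m := n) (ξ := fun y => -y) (τ := fun _ => 0) measurableSet_Ioi measurable_neg
    measurable_const hu hx (farFromSources_reflected hx 0) (fun _ _ => le_rfl)
  have h5 := hfar (m := n + 1) (ξ := fun _ => 0) (τ := fun τ => τ) measurableSet_Ioc
    measurable_const measurable_id (hg 1) hx (farFromSources_boundary hx _ _ 0)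
    (fun _ ha => ha.1.le)
  have h2 := (tendsto_integral_heatKernel_initial (v := fun j => iteratedDeriv j u₀)
    (half_lt_self hx) (show x < 2 * x by linarith) (fun j y hy => by
      rw [uIcc_of_le (by linarith)] at hy
      exact hud.hasDerivAt_iteratedDeriv j (hx2.trans_le hy.1)) n 0).comp hline
  have h := (((h1.add h2).add h3).sub h4).sub (h5.const_mul 2)
  simp only [zero_add, add_zero, sub_zero, mul_zero] at h
  refine h.congr' ?_
  have hlt : ∀ᶠ t : ℝ in 𝓝[>] 0, t < 1 := nhdsWithin_le_nhds (gt_mem_nhds one_pos)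
  filter_upwards [self_mem_nhdsWithin, hlt] with t ht ht1
  have i1 := integrableOn_heatPotential_integrand n measurableSet_Ioc measurable_id
    measurable_const hu1 ht (farFromSources_initial _ _ x t)
  have i2 := integrableOn_heatPotential_integrand n measurableSet_Ioc measurable_id
    measurable_const hu2 ht (farFromSources_initial _ _ x t)
  have i3 := integrableOn_heatPotential_integrand n measurableSet_Ioi measurable_id
    measurable_const hu3 ht (farFromSources_initial _ _ x t)
  rw [dirichletSolution, heatPotential_boundary_eq _ _ _ (le_of_lt ht1)]
  congr 2
  simp only [heatPotential, Function.comp_apply, iteratedDeriv_zero, sub_zero, id] at i1 i2 i3 ⊢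
  rw [intervalIntegral.integral_of_le (by linarith), ← setIntegral_union
    (Ioc_disjoint_Ioc_of_le le_rfl) measurableSet_Ioc i1 i2,
    Ioc_union_Ioc_eq_Ioc hx2.le (by linarith), ← setIntegral_union (Ioc_disjoint_Ioi le_rfl)
    measurableSet_Ioi ?_ i3, Ioc_union_Ioi_eq_Ioi (by linarith)]
  rw [← Ioc_union_Ioc_eq_Ioc hx2.le (show x / 2 ≤ 2 * x by linarith)]
  exact i1.union i2

lemma nhdsWithin_right_half_plane (t : ℝ) :
    𝓝[{p : ℝ × ℝ | 0 < p.1}] (0, t) = 𝓝[>] 0 ×ˢ 𝓝 t := by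
  rw [← nhdsWithin_univ t, ← nhdsWithin_prod_eq]
  congr 1
  ext p
  simp

/-- The space derivatives of the solution have limits on the boundary, locally uniformly in time,
and the solution itself tends to the boundary datum. -/
lemma tendsto_dirichletSolution_boundary (hu : IntegrableOn u₀ (Ioi 0))
    (hgd : ContDiffOn ℝ ∞ g₀ (Ioi 0)) (hg : ∀ T, IntegrableOn g₀ (Ioc 0 T)) (n : ℕ) {t : ℝ}
    (ht : 0 < t) :
    ∃ L, Tendsto (fun p : ℝ × ℝ => dirichletSolution u₀ g₀ n p.1 p.2) (𝓝[>] 0 ×ˢ 𝓝 t) (𝓝 L) ∧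
      (n = 0 → L = g₀ t) := by
  rw [← nhdsWithin_right_half_plane]
  have ht2 := half_pos ht
  have hg1 : IntegrableOn g₀ (Ioc 0 (t / 2)) := hg _
  have hg2 : IntegrableOn g₀ (Ioc (t / 2) (2 * t)) :=
    (hg (2 * t)).mono_set (Ioc_subset_Ioc_left ht2.le)
  have h1 := (continuousAt_heatPotential n measurableSet_Ioi measurable_id measurable_const hu
    (p := (0, t)) ht (farFromSources_initial _ _ 0 t)).mono_left
    (nhdsWithin_le_nhds (s := {p : ℝ × ℝ | 0 < p.1}))
  have h2 := (continuousAt_heatPotential n measurableSet_Ioi measurable_neg measurable_const hu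
    (p := (0, t)) ht (farFromSources_initial _ _ 0 t)).mono_left
    (nhdsWithin_le_nhds (s := {p : ℝ × ℝ | 0 < p.1}))
  have h3 := (continuousAt_heatPotential (n + 1) (ξ := fun _ => 0) (τ := fun τ => τ)
    measurableSet_Ioc measurable_const measurable_id hg1 (p := (0, t)) ht2
    (fun a ha => Or.inr (show t / 2 ≤ t - a by linarith [ha.2]))).mono_left
    (nhdsWithin_le_nhds (s := {p : ℝ × ℝ | 0 < p.1}))
  obtain ⟨L, h4, hL⟩ := tendsto_integral_heatKernel_boundary (v := fun j => iteratedDeriv j g₀)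
    (half_lt_self ht) (show t < 2 * t by linarith) (fun j y hy => by
      rw [uIcc_of_le (by linarith)] at hy
      exact hgd.hasDerivAt_iteratedDeriv j (ht2.trans_le hy.1)) (n + 1) 0
  refine ⟨_, ((h1.sub h2).sub ((h3.add h4).const_mul 2)).congr' ?_, ?_⟩
  · have hlt : ∀ᶠ p : ℝ × ℝ in 𝓝[{p | 0 < p.1}] (0, t), p.2 < 2 * t :=
      nhdsWithin_le_nhds (continuousAt_snd.eventually_lt_const (show t < 2 * t by linarith))
    filter_upwards [self_mem_nhdsWithin, hlt] with p hp hp2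
    have i1 := integrableOn_heatPotential_integrand (n + 1) measurableSet_Ioc measurable_const
      measurable_id hg1 hp (farFromSources_boundary hp _ _ p.2)
    have i2 := integrableOn_heatPotential_integrand (n + 1) measurableSet_Ioc measurable_const
      measurable_id hg2 hp (farFromSources_boundary hp _ _ p.2)
    rw [dirichletSolution, heatPotential_boundary_eq _ _ _ hp2.le]
    congr 2
    simp only [heatPotential, iteratedDeriv_zero, sub_zero, id] at i1 i2 ⊢
    rw [intervalIntegral.integral_of_le (by linarith), ← setIntegral_union
      (Ioc_disjoint_Ioc_of_le le_rfl) measurableSet_Ioc i1 i2,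
      Ioc_union_Ioc_eq_Ioc ht2.le (by linarith)]
  · -- on the boundary the datum and its odd reflection cancel, and `∂ₓK` vanishes off the source
    rintro rfl
    have e1 : heatPotential 0 (Ioi 0) id (fun _ => 0) u₀ 0 t =
        heatPotential 0 (Ioi 0) (fun y => -y) (fun _ => 0) u₀ 0 t := by
      simp [heatPotential, heatKernel]
    have e2 : heatPotential (0 + 1) (Ioc 0 (t / 2)) (fun _ => 0) (fun τ => τ) g₀ 0 t = 0 := by
      simp [heatPotential, heatKernel]
    rw [hL rfl]
    refine Eq.trans (congrArg₂ _ (sub_eq_zero.2 e1) (congrArg _ (congrArg₂ _ e2 rfl))) ?_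
    simp

end Dirichlet

/-! ### Decay at infinity -/

lemma heatKernel_bound_strip (n M : ℕ) {α β : ℝ} (hα : 0 < α) : ∃ C : ℝ, 0 ≤ C ∧ ∀ x : ℝ,
    ∀ t ∈ Icc α β, |x| ^ M * |heatKernel n x t| ≤ C := by
  obtain ⟨C, hC, h⟩ := heatKernel_bound n M
  have ha := Real.sqrt_pos.2 hα
  refine ⟨C * √β ^ M / √α ^ (n + 1), by positivity, fun x t ht => ?_⟩
  rw [le_div_iff₀ (by positivity)]
  calc |x| ^ M * |heatKernel n x t| * √α ^ (n + 1)
      ≤ |x| ^ M * |heatKernel n x t| * √t ^ (n + 1) := by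
        have := Real.sqrt_le_sqrt ht.1
        gcongr
    _ ≤ C * √t ^ M := h x t (hα.trans_le ht.1)
    _ ≤ C * √β ^ M := by
        have := Real.sqrt_le_sqrt ht.2
        gcongr

lemma heatPotential_initial_decay {u₀ : ℝ → ℂ} {ξ : ℝ → ℝ} (hξ : ∀ y, |ξ y| = |y|)
    (hu : ∀ M : ℕ, IntegrableOn (fun y => |y| ^ M * ‖u₀ y‖) (Ioi 0)) (n M : ℕ) {α β : ℝ}
    (hα : 0 < α) : ∃ C : ℝ, ∀ x : ℝ, ∀ t ∈ Icc α β,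
      ‖(x : ℂ) ^ M * heatPotential n (Ioi 0) ξ (fun _ => 0) u₀ x t‖ ≤ C := by
  obtain ⟨C, hC, h⟩ := heatKernel_bound_strip n M (β := β) hα
  obtain ⟨D, hD, h'⟩ := heatKernel_bound_strip n 0 (β := β) hα
  refine ⟨∫ y in Ioi 0, 2 ^ (M - 1) * (C * (|y| ^ 0 * ‖u₀ y‖) + D * (|y| ^ M * ‖u₀ y‖)),
    fun x t ht => ?_⟩
  rw [heatPotential, ← integral_const_mul]
  refine norm_integral_le_of_norm_le ((((hu 0).const_mul C).add ((hu M).const_mul D)).const_mul _)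
    (Eventually.of_forall fun y => ?_)
  rw [norm_mul, norm_pow, Complex.norm_real, norm_smul, Real.norm_eq_abs, Real.norm_eq_abs,
    sub_zero]
  have h1 : |x| ^ M ≤ 2 ^ (M - 1) * (|x - ξ y| ^ M + |y| ^ M) := by
    refine le_trans ?_ (add_pow_le (abs_nonneg _) (abs_nonneg _) M)
    gcongr
    rw [← hξ y]
    simpa using abs_add_le (x - ξ y) (ξ y)
  have h2 := h (x - ξ y) t ht
  have h3 := h' (x - ξ y) t ht
  rw [pow_zero, one_mul] at h3
  calc |x| ^ M * (|heatKernel n (x - ξ y) t| * ‖u₀ y‖)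
      ≤ 2 ^ (M - 1) * (|x - ξ y| ^ M + |y| ^ M) * (|heatKernel n (x - ξ y) t| * ‖u₀ y‖) := by
        gcongr
    _ = 2 ^ (M - 1) * ((|x - ξ y| ^ M * |heatKernel n (x - ξ y) t|) * ‖u₀ y‖ +
          |heatKernel n (x - ξ y) t| * (|y| ^ M * ‖u₀ y‖)) := by ring
    _ ≤ 2 ^ (M - 1) * (C * ‖u₀ y‖ + D * (|y| ^ M * ‖u₀ y‖)) := by gcongr
    _ = _ := by rw [pow_zero, one_mul]

lemma heatPotential_boundary_decay {g₀ : ℝ → ℂ} {β : ℝ} (hg : IntegrableOn g₀ (Ioc 0 β))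
    (n M : ℕ) : ∃ C : ℝ, ∀ x t : ℝ, 1 ≤ x → t ≤ β →
      ‖(x : ℂ) ^ M * heatPotential n (Ioc 0 t) (fun _ => 0) (fun τ => τ) g₀ x t‖ ≤ C := by
  obtain ⟨C, hC, h⟩ := heatKernel_bound_space n M
  refine ⟨∫ τ in Ioc 0 β, C * |β| ^ M * ‖g₀ τ‖, fun x t hx ht => ?_⟩
  rw [heatPotential_boundary_eq _ _ _ ht, heatPotential, ← integral_const_mul]
  refine norm_integral_le_of_norm_le (hg.norm.const_mul _) ?_
  filter_upwards [ae_restrict_mem measurableSet_Ioc] with τ hτ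
  rw [norm_mul, norm_pow, Complex.norm_real, norm_smul, Real.norm_eq_abs, Real.norm_eq_abs,
    sub_zero, ← mul_assoc]
  refine mul_le_mul_of_nonneg_right ?_ (norm_nonneg _)
  rcases le_or_gt (t - τ) 0 with hs | hs
  · rw [heatKernel_of_nonpos _ _ hs]; simp; positivity
  calc |x| ^ M * |heatKernel n x (t - τ)| ≤ |x| ^ (n + 1 + 2 * M) * |heatKernel n x (t - τ)| := by
        have : 1 ≤ |x| := by rwa [abs_of_pos (by linarith)]
        gcongr
        omega
    _ ≤ C * |t - τ| ^ M := h x (t - τ)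
    _ ≤ C * |β| ^ M := by
        have h1 : |t - τ| ≤ |β| := by
          rw [abs_of_pos hs]
          exact le_trans (by linarith [hτ.1]) (le_abs_self β)
        gcongr

lemma dirichletSolution_decay {u₀ g₀ : ℝ → ℂ}
    (hum : AEStronglyMeasurable u₀ (volume.restrict (Ioi 0)))
    (hu : ∀ M : ℕ, IntegrableOn (fun y => |y| ^ M * ‖u₀ y‖) (Ioi 0))
    (hgd : ContDiffOn ℝ ∞ g₀ (Ioi 0)) (hg : ∀ T, IntegrableOn g₀ (Ioc 0 T)) {α β : ℝ}
    (hα : 0 < α) (M N : ℕ) : ∃ C : ℝ, ∀ x : ℝ, 0 < x → ∀ t ∈ Icc α β,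
      ‖(x : ℂ) ^ M * dirichletSolution u₀ g₀ N x t‖ ≤ C := by
  have hu0 : IntegrableOn u₀ (Ioi 0) :=
    (integrable_norm_iff hum).1 (by simpa [IntegrableOn] using hu 0)
  -- near the boundary, the boundary limits and compactness give a bound
  have hnear : ∃ C : ℝ, ∀ p ∈ Icc (0 : ℝ) 1 ×ˢ Icc α β, 0 < p.1 →
      ‖dirichletSolution u₀ g₀ N p.1 p.2‖ ≤ C := by
    refine (isCompact_Icc.prod isCompact_Icc).induction_on
      (p := fun s : Set (ℝ × ℝ) => ∃ C : ℝ, ∀ p ∈ s, 0 < p.1 →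
        ‖dirichletSolution u₀ g₀ N p.1 p.2‖ ≤ C) ⟨0, by simp⟩ ?_ ?_ ?_
    · rintro s s' hs ⟨C, hC⟩
      exact ⟨C, fun p hp => hC p (hs hp)⟩
    · rintro s s' ⟨C, hC⟩ ⟨D, hD⟩
      refine ⟨max C D, fun p hp h0 => ?_⟩
      rcases hp with hp | hp
      · exact (hC p hp h0).trans (le_max_left _ _)
      · exact (hD p hp h0).trans (le_max_right _ _)
    · rintro ⟨x, t⟩ ⟨hx, ht⟩
      have ht0 : 0 < t := hα.trans_le ht.1
      obtain ⟨L, hL⟩ : ∃ L, Tendsto (fun p : ℝ × ℝ => dirichletSolution u₀ g₀ N p.1 p.2)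
          (𝓝[{p | 0 < p.1}] (x, t)) (𝓝 L) := by
        rcases eq_or_lt_of_le hx.1 with h | h
        · obtain ⟨L, hL, -⟩ := tendsto_dirichletSolution_boundary hu0 hgd hg N ht0
          rw [← nhdsWithin_right_half_plane] at hL
          exact ⟨L, by rw [← show (0 : ℝ) = x from h]; exact hL⟩
        · exact ⟨_, ((isHeatHierarchy_dirichletSolution hu0 hg).cont N (x, t)
            ⟨h, ht0⟩).mono_left nhdsWithin_le_nhds⟩
      have hev := hL.norm.eventually_le_const (lt_add_one ‖L‖)
      rw [eventually_nhdsWithin_iff] at hev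
      exact ⟨_, mem_nhdsWithin_of_mem_nhds hev, ‖L‖ + 1, fun p hp h0 => hp h0⟩
  obtain ⟨C, hC⟩ := hnear
  obtain ⟨C1, h1⟩ := heatPotential_initial_decay (ξ := fun y => y) (fun _ => rfl) hu N M
    (β := β) hα
  obtain ⟨C2, h2⟩ := heatPotential_initial_decay (ξ := fun y => -y) (fun y => abs_neg y) hu N M
    (β := β) hα
  obtain ⟨C3, h3⟩ := heatPotential_boundary_decay (hg β) (N + 1) M
  refine ⟨max C (C1 + C2 + 2 * C3), fun x hx t ht => ?_⟩
  rcases le_or_gt x 1 with hx1 | hx1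
  · refine le_trans ?_ (le_max_left _ _)
    rw [norm_mul, norm_pow, Complex.norm_real, Real.norm_eq_abs, abs_of_pos hx]
    exact (mul_le_of_le_one_left (norm_nonneg _) (pow_le_one₀ hx.le hx1)).trans
      (hC (x, t) ⟨⟨hx.le, hx1⟩, ht⟩ hx)
  · refine le_trans ?_ (le_max_right _ _)
    rw [dirichletSolution, mul_sub, mul_sub, mul_left_comm]
    refine (norm_sub_le _ _).trans (add_le_add ((norm_sub_le _ _).trans
      (add_le_add (h1 x t ht) (h2 x t ht))) ?_)
    rw [norm_mul, Complex.norm_two]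
    exact mul_le_mul_of_nonneg_left (h3 x t hx1.le ht.2) zero_le_two

/-! ### The contour integrals of the exponential -/

lemma integrableOn_pow_mul_exp (n : ℕ) {m : ℝ} (hm : 0 < m) :
    IntegrableOn (fun r : ℝ => r ^ n * Real.exp (-m * r)) (Ioi 0) := by
  have h := integrableOn_rpow_mul_exp_neg_mul_rpow (p := 1) (s := n) (b := m)
    (by have := n.cast_nonneg (α := ℝ); linarith) one_pos hm
  simpa only [Real.rpow_natCast, Real.rpow_one] using h

/-- On the rays `k = r (σ + ic)`, `0 ≤ c ≤ 1`, the exponential decays uniformly in `c`. -/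
lemma norm_exp_tilted_le {σ c r x s : ℝ} (hσ : σ ^ 2 = 1) (hc : c ∈ Icc (0 : ℝ) 1) (hr : 0 ≤ r)
    (hs : 0 < s) :
    ‖Complex.exp (Complex.I * (r * (σ + Complex.I * c)) * x - (r * (σ + Complex.I * c)) ^ 2 * s)‖
      ≤ Real.exp s * Real.exp (-min x s * r) := by
  rw [Complex.norm_exp, ← Real.exp_add, Real.exp_le_exp]
  have e : (Complex.I * (r * (σ + Complex.I * c)) * x - (r * (σ + Complex.I * c)) ^ 2 * s).re
      = -(r * c * x) - r ^ 2 * (σ ^ 2 - c ^ 2) * s := by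
    simp [pow_two]
    left
    ring
  rw [e, hσ]
  -- with `r² ≥ r - 1` the exponent is at most `s - min x s * r`, at the cost of the factor `e^s`
  have h1 : min x s * (r * c) ≤ x * (r * c) :=
    mul_le_mul_of_nonneg_right (min_le_left _ _) (mul_nonneg hr hc.1)
  have h2 : min x s * (r * (1 - c)) ≤ s * (r * (1 - c)) :=
    mul_le_mul_of_nonneg_right (min_le_right _ _) (mul_nonneg hr (sub_nonneg.2 hc.2))
  have h3 : (r - 1) * (1 - c) - c ≤ r ^ 2 * (1 - c ^ 2) := by
    nlinarith [hc.1, hc.2, sq_nonneg (r - 1), mul_nonneg (sq_nonneg r) (mul_nonneg hc.1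
      (sub_nonneg.2 hc.2)), mul_nonneg (sub_nonneg.2 hc.2) (sq_nonneg (r - 1)),
      mul_nonneg hr (sub_nonneg.2 hc.2)]
  nlinarith

lemma HasDerivAt.exp_heat {f : ℝ → ℂ} {f' : ℂ} {y : ℝ} (h : HasDerivAt f f' y) (x s : ℝ) :
    HasDerivAt (fun y => Complex.exp (Complex.I * f y * x - f y ^ 2 * s))
      (Complex.exp (Complex.I * f y * x - f y ^ 2 * s) *
        (Complex.I * f' * x - 2 * f y * f' * s)) y := by
  have h2 := (((h.const_mul Complex.I).mul_const (x : ℂ)).fun_sub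
    ((h.fun_pow 2).mul_const (s : ℂ))).cexp
  refine h2.congr_deriv ?_
  simp

/-- The rotation of a ray of integration of `e^{ikx - k²s}`: the integral over `k = r (σ + ic)`,
`r > 0`, does not depend on `c ∈ [0, 1]`, since its `c`-derivative is the integral of the
`r`-derivative of a function that vanishes at both ends. -/
lemma integral_exp_tilted_eq {σ x s : ℝ} (hσ : σ ^ 2 = 1) (hx : 0 < x) (hs : 0 < s) :
    ∫ r in Ioi (0 : ℝ), Complex.exp (Complex.I * (r * (σ + Complex.I)) * x
        - (r * (σ + Complex.I)) ^ 2 * s) * (σ + Complex.I) =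
      ∫ r in Ioi (0 : ℝ), Complex.exp (Complex.I * (r * σ) * x - (r * σ) ^ 2 * s) * σ := by
  set d : ℝ → ℂ := fun c => σ + Complex.I * c with hd
  set E : ℝ → ℝ → ℂ := fun c r => Complex.exp (Complex.I * (r * d c) * x - (r * d c) ^ 2 * s)
  set D : ℝ → ℝ → ℂ := fun c r =>
    E c r + r * (E c r * (Complex.I * d c * x - 2 * (r * d c) * d c * s)) with hD
  have hm : 0 < min x s := lt_min hx hs
  have hnd : ∀ c ∈ Icc (0 : ℝ) 1, ‖d c‖ ≤ 2 := by
    intro c hc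
    have h1 : |σ| = 1 := by rwa [← sq_eq_sq₀ (abs_nonneg _) zero_le_one, sq_abs, one_pow]
    have h2 : d c = σ + Complex.I * c := rfl
    rw [h2]
    refine (norm_add_le _ _).trans ?_
    rw [norm_mul, Complex.norm_I, Complex.norm_real, Complex.norm_real, Real.norm_eq_abs,
      Real.norm_eq_abs, h1, abs_of_nonneg hc.1]
    linarith [hc.2]
  have hE : ∀ c ∈ Icc (0 : ℝ) 1, ∀ r, 0 ≤ r →
      ‖E c r‖ ≤ Real.exp s * Real.exp (-min x s * r) :=
    fun c hc r hr => norm_exp_tilted_le hσ hc hr hs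
  have hDb : ∀ c ∈ Icc (0 : ℝ) 1, ∀ r, 0 ≤ r → ‖D c r‖ ≤
      Real.exp s * (r ^ 0 * Real.exp (-min x s * r)) +
      2 * x * Real.exp s * (r ^ 1 * Real.exp (-min x s * r)) +
      8 * s * Real.exp s * (r ^ 2 * Real.exp (-min x s * r)) := by
    intro c hc r hr
    have h1 : ‖Complex.I * d c * x - 2 * (r * d c) * d c * s‖ ≤ 2 * x + 8 * r * s := by
      refine (norm_sub_le _ _).trans ?_
      simp only [norm_mul, Complex.norm_I, Complex.norm_real, Real.norm_eq_abs, abs_of_pos hx,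
        abs_of_pos hs, abs_of_nonneg hr, Complex.norm_two, one_mul]
      have h := hnd c hc
      have h2 : ‖d c‖ * ‖d c‖ ≤ 2 * 2 := mul_le_mul h h (norm_nonneg _) zero_le_two
      have h3 : ‖d c‖ * x ≤ 2 * x := mul_le_mul_of_nonneg_right h hx.le
      have h4 := mul_le_mul_of_nonneg_left h2 (mul_nonneg hr hs.le)
      nlinarith
    calc ‖D c r‖ ≤ ‖E c r‖ + r * (‖E c r‖ * (2 * x + 8 * r * s)) := by
          have h2 : D c r = E c r +
            r * (E c r * (Complex.I * d c * x - 2 * (r * d c) * d c * s)) := rfl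
          rw [h2]
          refine (norm_add_le _ _).trans ?_
          rw [norm_mul, norm_mul, Complex.norm_real, Real.norm_eq_abs, abs_of_nonneg hr]
          gcongr
      _ ≤ Real.exp s * Real.exp (-min x s * r) +
          r * (Real.exp s * Real.exp (-min x s * r) * (2 * x + 8 * r * s)) := by
          have := hE c hc r hr
          gcongr
      _ = _ := by ring
  have hBint : IntegrableOn (fun r : ℝ => Real.exp s * (r ^ 0 * Real.exp (-min x s * r)) +
      2 * x * Real.exp s * (r ^ 1 * Real.exp (-min x s * r)) +
      8 * s * Real.exp s * (r ^ 2 * Real.exp (-min x s * r))) (Ioi 0) :=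
    (((integrableOn_pow_mul_exp 0 hm).const_mul _).add
      ((integrableOn_pow_mul_exp 1 hm).const_mul _)).add
      ((integrableOn_pow_mul_exp 2 hm).const_mul _)
  have hEc : ∀ c, Continuous (E c) := fun c => by simp only [E]; fun_prop
  have hDc : ∀ c, Continuous (D c) := fun c => by
    have := hEc c
    simp only [hD]
    fun_prop
  have hDint : ∀ c ∈ Icc (0 : ℝ) 1, IntegrableOn (D c) (Ioi 0) := fun c hc =>
    Integrable.mono' hBint (hDc c).aestronglyMeasurable
      ((ae_restrict_mem measurableSet_Ioi).mono fun r hr => hDb c hc r (le_of_lt hr))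
  have hEint : ∀ c ∈ Icc (0 : ℝ) 1, IntegrableOn (E c) (Ioi 0) := fun c hc =>
    Integrable.mono' (((integrableOn_pow_mul_exp 0 hm).const_mul (Real.exp s)))
      (hEc c).aestronglyMeasurable
      ((ae_restrict_mem measurableSet_Ioi).mono fun r hr => by
        simpa using hE c hc r (le_of_lt hr))
  have hrEint : ∀ c ∈ Icc (0 : ℝ) 1, IntegrableOn (fun r : ℝ => r * E c r) (Ioi 0) := fun c hc =>
    Integrable.mono' (((integrableOn_pow_mul_exp 1 hm).const_mul (Real.exp s)))
      (by have := hEc c; exact (by fun_prop : Continuous fun r : ℝ => r * E c r).aestronglyMeasurable)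
      ((ae_restrict_mem measurableSet_Ioi).mono fun r hr => by
        rw [norm_mul, Complex.norm_real, Real.norm_eq_abs, abs_of_pos hr]
        calc r * ‖E c r‖ ≤ r * (Real.exp s * Real.exp (-min x s * r)) :=
              mul_le_mul_of_nonneg_left (hE c hc r (le_of_lt hr)) (le_of_lt hr)
          _ = _ := by ring)
  have hrd : ∀ c r : ℝ, HasDerivAt (fun r : ℝ => r * E c r) (D c r) r := by
    intro c r
    have h0 : HasDerivAt (fun r : ℝ => (r : ℂ)) 1 r := Complex.ofRealCLM.hasDerivAt
    have h1 := h0.mul_const (d c)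
    refine (h0.fun_mul (h1.exp_heat x s)).congr_deriv ?_
    simp only [hD, E, one_mul]
  have hcd : ∀ c r : ℝ, HasDerivAt (fun c => E c r * d c) (Complex.I * D c r) c := by
    intro c r
    have h0 : HasDerivAt d Complex.I c := by
      have := ((Complex.ofRealCLM.hasDerivAt (x := c)).const_mul Complex.I).const_add (σ : ℂ)
      simpa [hd] using this
    refine (((h0.const_mul (r : ℂ)).exp_heat x s).fun_mul h0).congr_deriv ?_
    simp only [hD, E]
    ring
  have hDzero : ∀ c ∈ Icc (0 : ℝ) 1, ∫ r in Ioi (0 : ℝ), D c r = 0 := by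
    intro c hc
    have h := integral_Ioi_of_hasDerivAt_of_tendsto' (a := 0) (fun r _ => hrd c r) (hDint c hc)
      (tendsto_zero_of_hasDerivAt_of_integrableOn_Ioi (a := 0) (fun r _ => hrd c r) (hDint c hc)
        (hrEint c hc))
    simpa using h
  have hderiv : ∀ c ∈ Ioo (0 : ℝ) 1,
      HasDerivAt (fun c => ∫ r in Ioi (0 : ℝ), E c r * d c) 0 c := by
    intro c hc
    have h := (hasDerivAt_integral_of_dominated_loc_of_deriv_le
      (F := fun c r => E c r * d c) (F' := fun c r => Complex.I * D c r)
      (μ := volume.restrict (Ioi 0)) (x₀ := c) (Ioo_mem_nhds hc.1 hc.2)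
      (Eventually.of_forall fun c =>
        ((hEc c).mul continuous_const).aestronglyMeasurable)
      ((hEint c (Ioo_subset_Icc_self hc)).mul_const _)
      (continuous_const.mul (hDc c)).aestronglyMeasurable
      ((ae_restrict_mem measurableSet_Ioi).mono fun r hr c hc => by
        rw [norm_mul, Complex.norm_I, one_mul]
        exact hDb c (Ioo_subset_Icc_self hc) r (le_of_lt hr)) hBint
      (Eventually.of_forall fun r c _ => hcd c r)).2
    refine h.congr_deriv ?_
    rw [integral_const_mul, hDzero c (Ioo_subset_Icc_self hc), mul_zero]
  have hcont : ContinuousOn (fun c => ∫ r in Ioi (0 : ℝ), E c r * d c) (Icc 0 1) := by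
    refine continuousOn_of_dominated
      (bound := fun r => Real.exp s * (r ^ 0 * Real.exp (-min x s * r)) * 2)
      (fun c _ => ((hEc c).mul continuous_const).aestronglyMeasurable) ?_
      (((integrableOn_pow_mul_exp 0 hm).const_mul _).mul_const _) ?_
    · intro c hc
      filter_upwards [ae_restrict_mem measurableSet_Ioi] with r hr
      rw [norm_mul, pow_zero, one_mul]
      exact mul_le_mul (hE c hc r (le_of_lt hr)) (hnd c hc) (norm_nonneg _) (by positivity)
    · exact Eventually.of_forall fun r c _ => (hcd c r).continuousAt.continuousWithinAt
  have h := intervalIntegral.integral_eq_sub_of_hasDerivAt_of_le zero_le_one hcont hderiv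
    intervalIntegrable_const
  rw [intervalIntegral.integral_zero, eq_comm, sub_eq_zero] at h
  simpa [E, d] using h

lemma integral_exp_line (x : ℝ) {s : ℝ} (hs : 0 < s) :
    ∫ k : ℝ, Complex.exp (Complex.I * k * x - (k : ℂ) ^ 2 * s) =
      2 * Real.pi * (heatKernel 0 x s : ℝ) := by
  have h := fourierIntegral_gaussian (b := (s : ℂ)) (by simpa using hs) x
  have e : ∀ k : ℝ, Complex.exp (Complex.I * k * x - (k : ℂ) ^ 2 * s) =
      Complex.exp (Complex.I * x * k) * Complex.exp (-s * k ^ 2) := fun k => by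
    rw [← Complex.exp_add]; ring_nf
  simp_rw [e, h, heatKernel]
  have h1 : ((Real.pi : ℂ) / s) ^ (1 / 2 : ℂ) = (√(Real.pi / s) : ℝ) := by
    rw [Real.sqrt_eq_rpow, Complex.ofReal_cpow (by positivity)]
    simp
  have h2 : √(Real.pi / s) = 2 * Real.pi * (√(4 * Real.pi * s))⁻¹ := by
    have hp : 0 < √(4 * Real.pi * s) := Real.sqrt_pos.2 (by positivity)
    rw [eq_mul_inv_iff_mul_eq₀ hp.ne', ← Real.sqrt_mul (by positivity),
      show Real.pi / s * (4 * Real.pi * s) = (2 * Real.pi) ^ 2 by field_simp; ring,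
      Real.sqrt_sq (by positivity)]
  rw [h1, h2]
  push_cast
  ring

lemma integrable_exp_line (x : ℝ) {s : ℝ} (hs : 0 < s) :
    Integrable fun k : ℝ => Complex.exp (Complex.I * k * x - (k : ℂ) ^ 2 * s) := by
  have h := integrable_cexp_quadratic (b := (s : ℂ)) (by simpa using hs) (Complex.I * x) 0
  refine h.congr (Eventually.of_forall fun k => ?_)
  simp only
  ring_nf

lemma rightDir_eq : rightDir = (√2 / 2 : ℝ) * ((1 : ℝ) + Complex.I) := by
  rw [rightDir, Complex.exp_mul_I, ← Complex.ofReal_cos, ← Complex.ofReal_sin, Real.cos_pi_div_four,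
    Real.sin_pi_div_four]
  push_cast
  ring

lemma leftDir_eq : leftDir = (√2 / 2 : ℝ) * ((-1 : ℝ) + Complex.I) := by
  have h : 3 * Real.pi / 4 = Real.pi - Real.pi / 4 := by ring
  rw [leftDir, Complex.exp_mul_I, ← Complex.ofReal_cos, ← Complex.ofReal_sin, h, Real.cos_pi_sub,
    Real.sin_pi_sub, Real.cos_pi_div_four, Real.sin_pi_div_four]
  push_cast
  ring

lemma integral_ray_rescale (F : ℂ → ℂ) {a : ℝ} (ha : 0 < a) (d : ℂ) :
    ∫ r in Ioi (0 : ℝ), F (r * (a * d)) * (a * d) = ∫ r in Ioi (0 : ℝ), F (r * d) * d := by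
  have h := integral_comp_mul_left_Ioi (fun r : ℝ => F (r * d) * d) 0 ha
  rw [mul_zero] at h
  have e : ∀ r : ℝ, F (r * (a * d)) * (a * d) = (a : ℂ) * (F ((a * r : ℝ) * d) * d) := fun r => by
    rw [show (r : ℂ) * (a * d) = (a * r : ℝ) * d by push_cast; ring]
    ring
  simp_rw [e]
  rw [integral_const_mul, h, Complex.real_smul, ← mul_assoc, ← Complex.ofReal_mul,
    mul_inv_cancel₀ ha.ne', Complex.ofReal_one, one_mul]

lemma contourIntegral_exp {x s : ℝ} (hx : 0 < x) (hs : 0 < s) :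
    contourIntegral (fun k => Complex.exp (Complex.I * k * x - k ^ 2 * s)) =
      2 * Real.pi * (heatKernel 0 x s : ℝ) := by
  have ha : 0 < √2 / 2 := by positivity
  rw [contourIntegral, rightDir_eq, leftDir_eq,
    integral_ray_rescale (fun k => Complex.exp (Complex.I * k * x - k ^ 2 * s)) ha,
    integral_ray_rescale (fun k => Complex.exp (Complex.I * k * x - k ^ 2 * s)) ha,
    integral_exp_tilted_eq (by norm_num) hx hs, integral_exp_tilted_eq (by norm_num) hx hs,
    ← integral_exp_line x hs]
  have h := integral_comp_neg_Ioi (0 : ℝ)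
    fun k : ℝ => Complex.exp (Complex.I * k * x - (k : ℂ) ^ 2 * s)
  rw [neg_zero] at h
  have hi := integrable_exp_line x hs
  rw [← intervalIntegral.integral_Iic_add_Ioi hi.integrableOn hi.integrableOn, ← h]
  simp only [Complex.ofReal_one, mul_one, Complex.ofReal_neg, mul_neg, integral_neg]
  ring

lemma rightDir_sq_re : (rightDir ^ 2).re = 0 := by
  rw [rightDir_eq]
  simp [pow_two]

lemma leftDir_sq_re : (leftDir ^ 2).re = 0 := by
  rw [leftDir_eq]
  simp [pow_two]

lemma rightDir_im_pos : 0 < rightDir.im := by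
  rw [rightDir_eq]
  simp

lemma leftDir_im_pos : 0 < leftDir.im := by
  rw [leftDir_eq]
  simp

/-- On the rays of `Γ` the factor `e^{-k²t}` is unimodular, and the decay comes from `e^{ikx}`. -/
lemma norm_exp_ray {d : ℂ} (hd : (d ^ 2).re = 0) (r x t : ℝ) :
    ‖Complex.exp (Complex.I * (r * d) * x - (r * d) ^ 2 * t)‖ = Real.exp (-(d.im * x) * r) := by
  rw [Complex.norm_exp]
  congr 1
  have h : (((r : ℂ) * d) ^ 2 * t).re = 0 := by
    rw [mul_pow, ← Complex.ofReal_pow, Complex.re_mul_ofReal, Complex.re_ofReal_mul, hd]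
    simp
  rw [Complex.sub_re, h]
  simp
  ring

lemma integrableOn_exp_ray {d : ℂ} (hd : (d ^ 2).re = 0) (hd' : 0 < d.im) {x : ℝ} (hx : 0 < x)
    (t : ℝ) (n : ℕ) : IntegrableOn (fun r : ℝ =>
      (r * d) ^ n * Complex.exp (Complex.I * (r * d) * x - (r * d) ^ 2 * t)) (Ioi 0) := by
  refine Integrable.mono' ((integrableOn_pow_mul_exp n (mul_pos hd' hx)).const_mul (‖d‖ ^ n))
    (by fun_prop) ?_
  filter_upwards [ae_restrict_mem measurableSet_Ioi] with r hr
  rw [norm_mul, norm_exp_ray hd, norm_pow, norm_mul, Complex.norm_real, Real.norm_eq_abs,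
    abs_of_pos hr]
  refine le_of_eq ?_
  ring

/-- Integration of `d/dk e^{ikx - k²s}` over a ray. -/
lemma ray_moment_relation {d : ℂ} (hd : (d ^ 2).re = 0) (hd' : 0 < d.im) {x : ℝ} (hx : 0 < x)
    (s : ℝ) :
    Complex.I * x * (∫ r in Ioi (0 : ℝ),
        Complex.exp (Complex.I * (r * d) * x - (r * d) ^ 2 * s) * d) -
      2 * s * (∫ r in Ioi (0 : ℝ),
        (r * d) * Complex.exp (Complex.I * (r * d) * x - (r * d) ^ 2 * s) * d) = -1 := by
  have i0 : IntegrableOn (fun r : ℝ => Complex.exp (Complex.I * (r * d) * x - (r * d) ^ 2 * s))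
      (Ioi 0) := by simpa using integrableOn_exp_ray hd hd' hx s 0
  have i1 : IntegrableOn (fun r : ℝ =>
      (r * d) * Complex.exp (Complex.I * (r * d) * x - (r * d) ^ 2 * s)) (Ioi 0) := by
    simpa using integrableOn_exp_ray hd hd' hx s 1
  have j0 := (i0.mul_const d).const_mul (Complex.I * x)
  have j1 := (i1.mul_const d).const_mul (2 * s : ℂ)
  have hder : ∀ r ∈ Ici (0 : ℝ), HasDerivAt
      (fun r : ℝ => Complex.exp (Complex.I * (r * d) * x - (r * d) ^ 2 * s))
      (Complex.I * x * (Complex.exp (Complex.I * (r * d) * x - (r * d) ^ 2 * s) * d) -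
        2 * s * ((r * d) * Complex.exp (Complex.I * (r * d) * x - (r * d) ^ 2 * s) * d)) r := by
    intro r _
    have h0 : HasDerivAt (fun r : ℝ => (r : ℂ)) 1 r := Complex.ofRealCLM.hasDerivAt
    have h1 := h0.mul_const d
    refine (h1.exp_heat x s).congr_deriv ?_
    ring
  have h := integral_Ioi_of_hasDerivAt_of_tendsto' hder (j0.sub j1)
    (tendsto_zero_of_hasDerivAt_of_integrableOn_Ioi (fun r hr => hder r (Ioi_subset_Ici_self hr))
      (j0.sub j1) i0)
  rw [integral_sub j0 j1, integral_const_mul, integral_const_mul] at h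
  rw [h]
  simp

lemma contourIntegral_mul_exp {x s : ℝ} (hx : 0 < x) (hs : 0 < s) :
    contourIntegral (fun k => k * Complex.exp (Complex.I * k * x - k ^ 2 * s)) =
      -(2 * Real.pi * Complex.I) * (heatKernel 1 x s : ℝ) := by
  have h0 := contourIntegral_exp hx hs
  have h1 := ray_moment_relation rightDir_sq_re rightDir_im_pos hx s
  have h2 := ray_moment_relation leftDir_sq_re leftDir_im_pos hx s
  rw [contourIntegral] at h0 ⊢
  rw [heatKernel]
  have hs' : (s : ℂ) ≠ 0 := Complex.ofReal_ne_zero.2 hs.ne'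
  push_cast
  refine mul_left_cancel₀ (mul_ne_zero two_ne_zero hs') ?_
  rw [mul_sub]
  have h3 : 2 * (s : ℂ) * (-(2 * Real.pi * Complex.I) * (-(x / (2 * s)) * (heatKernel 0 x s : ℝ))) =
      Complex.I * x * (2 * Real.pi * (heatKernel 0 x s : ℝ)) := by
    field_simp
  rw [h3, ← h0]
  linear_combination h2 - h1

/-! ### From the contour formula to physical space -/

section Fubini

variable {S S' : Set ℝ} {Φ : ℝ → ℝ → ℂ} {B : ℝ → ℝ} {w : ℝ → ℂ}

lemma integrable_kernel_mul (hS : MeasurableSet S) (hS' : MeasurableSet S')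
    (hΦ : Continuous fun p : ℝ × ℝ => Φ p.1 p.2) (hB : IntegrableOn B S) (hw : IntegrableOn w S')
    (hb : ∀ k ∈ S, ∀ y ∈ S', ‖Φ k y‖ ≤ B k) :
    Integrable (fun p : ℝ × ℝ => Φ p.1 p.2 * w p.2)
      ((volume.restrict S).prod (volume.restrict S')) := by
  refine Integrable.mono' (hB.mul_prod hw.norm)
    (hΦ.aestronglyMeasurable.mul hw.aestronglyMeasurable.comp_snd) ?_
  rw [Measure.prod_restrict]
  filter_upwards [ae_restrict_mem (hS.prod hS')] with p hp
  rw [norm_mul]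
  exact mul_le_mul_of_nonneg_right (hb _ hp.1 _ hp.2) (norm_nonneg _)

lemma integral_kernel_mul_swap (hS : MeasurableSet S) (hS' : MeasurableSet S')
    (hΦ : Continuous fun p : ℝ × ℝ => Φ p.1 p.2) (hB : IntegrableOn B S) (hw : IntegrableOn w S')
    (hb : ∀ k ∈ S, ∀ y ∈ S', ‖Φ k y‖ ≤ B k) :
    ∫ k in S, ∫ y in S', Φ k y * w y = ∫ y in S', (∫ k in S, Φ k y) * w y := by
  rw [integral_integral_swap (integrable_kernel_mul hS hS' hΦ hB hw hb)]
  simp_rw [integral_mul_const]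

end Fubini

/-- Fubini's theorem for a contour integral over `Γ` of a superposition `∫ G(k,y) w(y) dy`. -/
lemma contourIntegral_superposition {S : Set ℝ} (hS : MeasurableSet S) {G : ℂ → ℝ → ℂ} {w : ℝ → ℂ}
    (hw : IntegrableOn w S) (hG : Continuous fun p : ℂ × ℝ => G p.1 p.2)
    (hb : ∀ d : ℂ, (d ^ 2).re = 0 → 0 < d.im → ∃ B : ℝ → ℝ, IntegrableOn B (Ioi 0) ∧
      ∀ r ∈ Ioi (0 : ℝ), ∀ y ∈ S, ‖G (r * d) y‖ ≤ B r) :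
    ContourIntegrable (fun k => ∫ y in S, G k y * w y) ∧
      contourIntegral (fun k => ∫ y in S, G k y * w y) =
        ∫ y in S, contourIntegral (fun k => G k y) * w y := by
  have hray : ∀ d : ℂ, (d ^ 2).re = 0 → 0 < d.im →
      IntegrableOn (fun r : ℝ => ∫ y in S, G (r * d) y * w y) (Ioi 0) ∧
      IntegrableOn (fun y => (∫ r in Ioi (0 : ℝ), G (r * d) y * d) * w y) S ∧
      ∫ r in Ioi (0 : ℝ), (∫ y in S, G (r * d) y * w y) * d =
        ∫ y in S, (∫ r in Ioi (0 : ℝ), G (r * d) y * d) * w y := by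
    intro d hd hd'
    obtain ⟨B, hB, hb⟩ := hb d hd hd'
    have hc : Continuous fun p : ℝ × ℝ => G (p.1 * d) p.2 :=
      hG.comp (by fun_prop : Continuous fun p : ℝ × ℝ => ((p.1 : ℂ) * d, p.2))
    have hi := integrable_kernel_mul (Φ := fun r y => G (r * d) y) measurableSet_Ioi hS hc hB hw hb
    have e : ∀ y, (∫ r in Ioi (0 : ℝ), G (r * d) y * d) * w y =
        (∫ r in Ioi (0 : ℝ), G (r * d) y * w y) * d := fun y => by
      rw [integral_mul_const, integral_mul_const]
      ring
    refine ⟨hi.integral_prod_left, ?_, ?_⟩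
    · simp_rw [e]
      exact hi.integral_prod_right.mul_const d
    · simp_rw [e]
      rw [integral_mul_const, integral_mul_const, integral_integral_swap hi]
  obtain ⟨r1, r2, r3⟩ := hray _ rightDir_sq_re rightDir_im_pos
  obtain ⟨l1, l2, l3⟩ := hray _ leftDir_sq_re leftDir_im_pos
  refine ⟨⟨r1, l1⟩, ?_⟩
  simp only [contourIntegral, sub_mul]
  rw [r3, l3, integral_sub r2 l2]

lemma lineIntegrand_eq (u₀ : ℝ → ℂ) (x t : ℝ) (k : ℂ) :
    lineIntegrand u₀ x t k = ∫ y in Ioi (0 : ℝ),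
      Complex.exp (Complex.I * k * (x - y : ℝ) - k ^ 2 * t) * u₀ y := by
  rw [lineIntegrand, halfLineFourier, ← integral_const_mul]
  congr 1
  ext y
  rw [mul_left_comm, ← Complex.exp_add, mul_comm]
  congr 2
  push_cast
  ring

lemma initialIntegrand_eq (u₀ : ℝ → ℂ) (x t : ℝ) (k : ℂ) :
    initialIntegrand u₀ x t k = ∫ y in Ioi (0 : ℝ),
      Complex.exp (Complex.I * k * (x + y : ℝ) - k ^ 2 * t) * u₀ y := by
  rw [initialIntegrand, halfLineFourier, ← integral_const_mul]
  congr 1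
  ext y
  rw [mul_left_comm, ← Complex.exp_add, mul_comm]
  congr 2
  push_cast
  ring

lemma boundaryIntegrand_eq (g₀ : ℝ → ℂ) (x : ℝ) {t : ℝ} (ht : 0 < t) (k : ℂ) :
    boundaryIntegrand g₀ x t k = ∫ τ in Ioc 0 t,
      k * Complex.exp (Complex.I * k * x - k ^ 2 * (t - τ : ℝ)) * g₀ τ := by
  rw [boundaryIntegrand, timeTransform, intervalIntegral.integral_of_le ht.le, ← mul_assoc,
    ← integral_const_mul]
  congr 1
  ext τ
  rw [show Complex.I * k * x - k ^ 2 * (t - τ : ℝ) =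
    Complex.I * k * x - k ^ 2 * t + k ^ 2 * τ by push_cast; ring, Complex.exp_add]
  ring

section Representation

variable {u₀ g₀ : ℝ → ℂ} {x t : ℝ}

lemma integral_lineIntegrand (hu : IntegrableOn u₀ (Ioi 0)) (x : ℝ) (ht : 0 < t) :
    Integrable (fun k : ℝ => lineIntegrand u₀ x t k) ∧
      ∫ k : ℝ, lineIntegrand u₀ x t k =
        2 * Real.pi * heatPotential 0 (Ioi 0) (fun y => y) (fun _ => 0) u₀ x t := by
  have hc : Continuous fun p : ℝ × ℝ =>
      Complex.exp (Complex.I * (p.1 : ℂ) * (x - p.2 : ℝ) - (p.1 : ℂ) ^ 2 * t) := by fun_prop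
  have hB : IntegrableOn (fun k : ℝ => Real.exp (-t * k ^ 2)) univ :=
    (integrable_exp_neg_mul_sq ht).integrableOn
  have hb : ∀ k ∈ (univ : Set ℝ), ∀ y ∈ Ioi (0 : ℝ),
      ‖Complex.exp (Complex.I * (k : ℂ) * (x - y : ℝ) - (k : ℂ) ^ 2 * t)‖ ≤
        Real.exp (-t * k ^ 2) := by
    intro k _ y _
    rw [Complex.norm_exp]
    refine le_of_eq (congrArg _ ?_)
    simp [pow_two]
    ring
  simp_rw [lineIntegrand_eq]
  constructor
  · have := (integrable_kernel_mul (Φ := fun k y =>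
      Complex.exp (Complex.I * (k : ℂ) * (x - y : ℝ) - (k : ℂ) ^ 2 * t)) MeasurableSet.univ
      measurableSet_Ioi hc hB hu hb).integral_prod_left
    simpa using this
  · have := integral_kernel_mul_swap (Φ := fun k y =>
      Complex.exp (Complex.I * (k : ℂ) * (x - y : ℝ) - (k : ℂ) ^ 2 * t)) MeasurableSet.univ
      measurableSet_Ioi hc hB hu hb
    rw [Measure.restrict_univ] at this
    rw [this, heatPotential, ← integral_const_mul]
    congr 1
    ext y
    rw [integral_exp_line _ ht, sub_zero, Complex.real_smul, mul_assoc]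

lemma contourIntegral_initialIntegrand (hu : IntegrableOn u₀ (Ioi 0)) (hx : 0 < x) (ht : 0 < t) :
    ContourIntegrable (initialIntegrand u₀ x t) ∧
      contourIntegral (initialIntegrand u₀ x t) =
        2 * Real.pi * heatPotential 0 (Ioi 0) (fun y => -y) (fun _ => 0) u₀ x t := by
  have e : initialIntegrand u₀ x t = fun k => ∫ y in Ioi (0 : ℝ),
      Complex.exp (Complex.I * k * (x + y : ℝ) - k ^ 2 * t) * u₀ y :=
    funext fun k => initialIntegrand_eq u₀ x t k
  obtain ⟨h1, h2⟩ := contourIntegral_superposition measurableSet_Ioi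
    (G := fun k y => Complex.exp (Complex.I * k * (x + y : ℝ) - k ^ 2 * t)) hu (by fun_prop)
    (fun d hd hd' => ⟨fun r => r ^ 0 * Real.exp (-(d.im * x) * r),
      integrableOn_pow_mul_exp 0 (mul_pos hd' hx), fun r hr y hy => by
        have hr' : 0 < r := hr
        have hy' : 0 < y := hy
        simp only [norm_exp_ray hd, pow_zero, one_mul, Real.exp_le_exp]
        nlinarith [mul_pos (mul_pos hd' hy') hr']⟩)
  rw [e]
  refine ⟨h1, ?_⟩
  rw [h2, heatPotential, ← integral_const_mul]
  refine setIntegral_congr_fun measurableSet_Ioi fun y hy => ?_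
  have hy' : 0 < y := hy
  rw [contourIntegral_exp (add_pos hx hy') ht, sub_zero, sub_neg_eq_add, Complex.real_smul,
    mul_assoc]

lemma contourIntegral_boundaryIntegrand (hg : IntegrableOn g₀ (Ioc 0 t)) (hx : 0 < x)
    (ht : 0 < t) :
    ContourIntegrable (boundaryIntegrand g₀ x t) ∧
      contourIntegral (boundaryIntegrand g₀ x t) = -(2 * Real.pi * Complex.I) *
        heatPotential 1 (Ioc 0 t) (fun _ => 0) (fun τ => τ) g₀ x t := by
  have e : boundaryIntegrand g₀ x t = fun k => ∫ τ in Ioc 0 t,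
      k * Complex.exp (Complex.I * k * x - k ^ 2 * (t - τ : ℝ)) * g₀ τ :=
    funext fun k => boundaryIntegrand_eq g₀ x ht k
  obtain ⟨h1, h2⟩ := contourIntegral_superposition measurableSet_Ioc
    (G := fun k τ => k * Complex.exp (Complex.I * k * x - k ^ 2 * (t - τ : ℝ))) hg (by fun_prop)
    (fun d hd hd' => ⟨fun r => ‖d‖ * (r ^ 1 * Real.exp (-(d.im * x) * r)),
      (integrableOn_pow_mul_exp 1 (mul_pos hd' hx)).const_mul _, fun r hr y hy => by
        have hr' : 0 < r := hr
        rw [norm_mul, norm_exp_ray hd, norm_mul, Complex.norm_real, Real.norm_eq_abs,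
          abs_of_pos hr']
        refine le_of_eq ?_
        ring⟩)
  rw [e]
  refine ⟨h1, ?_⟩
  rw [h2, heatPotential, ← integral_const_mul]
  refine setIntegral_congr_ae measurableSet_Ioc ?_
  -- the formula for the kernel needs a positive time lag, which excludes the null set `τ = t`
  have hne : ∀ᵐ τ : ℝ, τ ≠ t := by simp [ae_iff]
  filter_upwards [hne] with τ hτ hτ'
  rw [contourIntegral_mul_exp hx (sub_pos.2 (lt_of_le_of_ne hτ'.2 hτ)), sub_zero,
    Complex.real_smul, mul_assoc]

/-- The contour formula agrees with the classical representation by the method of images. -/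
lemma fokas_eq_dirichletSolution (hu : IntegrableOn u₀ (Ioi 0)) (hg : ∀ T, IntegrableOn g₀ (Ioc 0 T))
    (hx : 0 < x) (ht : 0 < t) : fokas u₀ g₀ x t = dirichletSolution u₀ g₀ 0 x t := by
  rw [fokas, (integral_lineIntegrand hu x ht).2, (contourIntegral_initialIntegrand hu hx ht).2,
    (contourIntegral_boundaryIntegrand (hg t) hx ht).2, dirichletSolution]
  have hpi : (Real.pi : ℂ) ≠ 0 := Complex.ofReal_ne_zero.2 Real.pi_ne_zero
  field_simp
  rw [Complex.I_sq]
  ring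

end Representation

/-! ### Integrability of the data -/

lemma SchwartzHalfLine.integrableOn_pow_mul {u₀ : ℝ → ℂ} (hu : SchwartzHalfLine u₀) (M : ℕ) :
    IntegrableOn (fun y => |y| ^ M * ‖u₀ y‖) (Ioi 0) := by
  obtain ⟨⟨hd, -⟩, hb⟩ := hu
  obtain ⟨C, hC⟩ := hb M 0
  obtain ⟨D, hD⟩ := hb (M + 2) 0
  have hm : AEStronglyMeasurable u₀ (volume.restrict (Ioi 0)) :=
    hd.continuousOn.aestronglyMeasurable measurableSet_Ioi
  -- `(1 + y²) |y|^M |u₀ y|` is bounded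
  refine Integrable.mono' ((integrable_inv_one_add_sq.const_mul (C + D)).integrableOn)
    (AEStronglyMeasurable.mul (by fun_prop) hm.norm) ?_
  filter_upwards [ae_restrict_mem measurableSet_Ioi] with y hy
  have h1 := hC y hy
  have h2 := hD y hy
  rw [iteratedDeriv_zero, norm_mul, norm_pow, Complex.norm_real, Real.norm_eq_abs] at h1 h2
  rw [norm_mul, norm_pow, Real.norm_eq_abs, abs_abs, norm_norm, ← div_eq_mul_inv,
    le_div_iff₀ (by positivity)]
  rw [pow_add, sq_abs] at h2
  linarith

lemma SchwartzHalfLine.aestronglyMeasurable {u₀ : ℝ → ℂ} (hu : SchwartzHalfLine u₀) :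
    AEStronglyMeasurable u₀ (volume.restrict (Ioi 0)) :=
  hu.1.1.continuousOn.aestronglyMeasurable measurableSet_Ioi

lemma SchwartzHalfLine.integrableOn {u₀ : ℝ → ℂ} (hu : SchwartzHalfLine u₀) :
    IntegrableOn u₀ (Ioi 0) :=
  (integrable_norm_iff hu.aestronglyMeasurable).1
    (by simpa [IntegrableOn] using hu.integrableOn_pow_mul 0)

lemma SmoothHalfLine.integrableOn_Ioc {g₀ : ℝ → ℂ} (hg : SmoothHalfLine g₀) (T : ℝ) :
    IntegrableOn g₀ (Ioc 0 T) := by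
  obtain ⟨L, hL⟩ := hg.2 0
  rw [iteratedDeriv_zero] at hL
  have hsub : Icc 0 T \ {0} ⊆ Ioi 0 := fun y hy => lt_of_le_of_ne hy.1.1 (Ne.symm hy.2)
  -- redefining the value at `0`, which is irrelevant, gives a continuous function on `[0, T]`
  have h : ContinuousOn (Function.update g₀ 0 L) (Icc 0 T) :=
    continuousOn_update_iff.2 ⟨hg.1.continuousOn.mono hsub,
      fun _ => hL.mono_left (nhdsWithin_mono _ hsub)⟩
  refine (h.integrableOn_Icc.mono_set Ioc_subset_Icc_self).congr_fun (fun y hy => ?_)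
    measurableSet_Ioc
  exact Function.update_of_ne (ne_of_gt hy.1) _ _

/-! ### The initial-boundary value problem -/

theorem theorem1p1 (u₀ g₀ : ℝ → ℂ) (hu₀ : SchwartzHalfLine u₀) (hg₀ : SmoothHalfLine g₀) :
    -- all integrals in the formula for `u` converge absolutely
    ((∀ k : ℂ, k.im ≤ 0 →
        IntegrableOn (fun x : ℝ => u₀ x * Complex.exp (-(Complex.I * k * x))) (Ioi 0)) ∧
      (∀ (k : ℂ) (t : ℝ), 0 < t →
        IntervalIntegrable (fun τ : ℝ => Complex.exp (k ^ 2 * τ) * g₀ τ) volume 0 t) ∧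
      (∀ x t : ℝ, 0 < x → 0 < t →
        Integrable (fun k : ℝ => lineIntegrand u₀ x t k) ∧
        ContourIntegrable (initialIntegrand u₀ x t) ∧
        ContourIntegrable (boundaryIntegrand g₀ x t))) ∧
    -- `u` is smooth on the open quadrant
    ContDiffOn ℝ ∞ (fun p : ℝ × ℝ => fokas u₀ g₀ p.1 p.2) openQuadrant ∧
    -- the heat equation
    (∀ x t : ℝ, 0 < x → 0 < t →
      deriv (fun s => fokas u₀ g₀ x s) t = iteratedDeriv 2 (fun y => fokas u₀ g₀ y t) x) ∧
    -- initial and boundary conditions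
    (∀ x : ℝ, 0 < x → Tendsto (fun t => fokas u₀ g₀ x t) (𝓝[>] 0) (𝓝 (u₀ x))) ∧
    (∀ t : ℝ, 0 < t → Tendsto (fun x => fokas u₀ g₀ x t) (𝓝[>] 0) (𝓝 (g₀ t))) ∧
    -- smoothness in `x` up to `x = 0`, and smoothness of the traces `g_n`
    (∀ t : ℝ, 0 < t → SmoothHalfLine (fun x => fokas u₀ g₀ x t)) ∧
    (∃ g : ℕ → ℝ → ℂ, ∀ n : ℕ,
      (∀ t : ℝ, 0 < t →
        Tendsto (iteratedDeriv n (fun x => fokas u₀ g₀ x t)) (𝓝[>] 0) (𝓝 (g n t))) ∧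
      ContDiffOn ℝ ∞ (g n) (Ioi 0)) ∧
    -- smoothness in `t` up to `t = 0`, and smoothness of the traces `u_n`
    (∀ x : ℝ, 0 < x → SmoothHalfLine (fun t => fokas u₀ g₀ x t)) ∧
    (∃ v : ℕ → ℝ → ℂ, ∀ n : ℕ,
      (∀ x : ℝ, 0 < x →
        Tendsto (iteratedDeriv n (fun t => fokas u₀ g₀ x t)) (𝓝[>] 0) (𝓝 (v n x))) ∧
      ContDiffOn ℝ ∞ (v n) (Ioi 0)) ∧
    -- rapid decrease as `x → +∞`
    RapidlyDecreasingLocUnif (fokas u₀ g₀) := by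
  have hu := hu₀.integrableOn
  have hg := hg₀.integrableOn_Ioc
  have hF := isHeatHierarchy_dirichletSolution hu hg
  have heq : ∀ x t, 0 < x → 0 < t → fokas u₀ g₀ x t = dirichletSolution u₀ g₀ 0 x t :=
    fun x t hx ht => fokas_eq_dirichletSolution hu hg hx ht
  have hspace : ∀ n x t, 0 < x → 0 < t →
      iteratedDeriv n (fun y => fokas u₀ g₀ y t) x = dirichletSolution u₀ g₀ n x t :=
    fun n x t hx ht => iteratedDeriv_eq_of_hasDerivAt
      (f := fun n y => dirichletSolution u₀ g₀ n y t) (fun y hy => heq y t hy ht)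
      (fun n y hy => hF.space n y t hy ht) n hx
  have htime : ∀ n x t, 0 < x → 0 < t →
      iteratedDeriv n (fun s => fokas u₀ g₀ x s) t = dirichletSolution u₀ g₀ (2 * n) x t :=
    fun n x t hx ht => iteratedDeriv_eq_of_hasDerivAt
      (f := fun n => dirichletSolution u₀ g₀ (2 * n) x) (fun s hs => heq x s hx hs)
      (hF.time_iterate hx) n ht
  have hinit : ∀ n x, 0 < x → Tendsto (dirichletSolution u₀ g₀ n x) (𝓝[>] 0)
      (𝓝 (iteratedDeriv n u₀ x)) := fun n x hx =>
    tendsto_dirichletSolution_initial hu hu₀.1.1 hg n hx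
  choose! g hgt hg0 using fun n t (ht : 0 < t) =>
    tendsto_dirichletSolution_boundary (u₀ := u₀) hu hg₀.1 hg n ht
  have hbdry : ∀ n t, 0 < t → Tendsto (fun x => dirichletSolution u₀ g₀ n x t) (𝓝[>] 0)
      (𝓝 (g n t)) := fun n t ht => by
    have hline : Tendsto (fun x : ℝ => (x, t)) (𝓝[>] 0) (𝓝[>] 0 ×ˢ 𝓝 t) :=
      tendsto_id.prodMk tendsto_const_nhds
    simpa only [Function.comp_def] using (hgt n t ht).comp hline
  have hgderiv : ∀ n t, 0 < t → HasDerivAt (g n) (g (n + 2) t) t := fun n t ht =>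
    hasDerivAt_trace (f := dirichletSolution u₀ g₀ n) (f' := dirichletSolution u₀ g₀ (n + 2))
      (fun x s hx hs => hF.time n x s hx hs) (hgt n) (hgt (n + 2)) ht
  refine ⟨⟨fun k hk => ?_, fun k t ht => ?_, fun x t hx ht =>
    ⟨(integral_lineIntegrand hu x ht).1, (contourIntegral_initialIntegrand hu hx ht).1,
      (contourIntegral_boundaryIntegrand (hg t) hx ht).1⟩⟩,
    (hF.contDiffOn 0).congr fun p hp => heq p.1 p.2 hp.1 hp.2,
    fun x t hx ht => ?_, fun x hx => ?_, fun t ht => ?_, fun t ht => ?_, ⟨g, fun n => ⟨?_, ?_⟩⟩,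
    fun x hx => ?_, ⟨fun n => iteratedDeriv (2 * n) u₀, fun n => ⟨?_, ?_⟩⟩,
    fun α β hα _ M N => ?_⟩
  · refine Integrable.mono hu (hu.1.mul (by fun_prop)) ?_
    filter_upwards [ae_restrict_mem measurableSet_Ioi] with x hx
    rw [norm_mul, Complex.norm_exp]
    refine mul_le_of_le_one_right (norm_nonneg _) (Real.exp_le_one_iff.2 ?_)
    have hx' : 0 < x := hx
    simpa using mul_nonpos_of_nonpos_of_nonneg hk hx'.le
  · refine IntervalIntegrable.continuousOn_mul ?_ (by fun_prop)
    exact (intervalIntegrable_iff_integrableOn_Ioc_of_le ht.le).2 (hg t)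
  · rw [hspace 2 x t hx ht]
    simpa using htime 1 x t hx ht
  · refine Tendsto.congr' ?_ (by simpa using hinit 0 x hx)
    filter_upwards [self_mem_nhdsWithin] with t ht using (heq x t hx ht).symm
  · have h := hbdry 0 t ht
    rw [hg0 0 t ht rfl] at h
    refine h.congr' ?_
    filter_upwards [self_mem_nhdsWithin] with x hx using (heq x t hx ht).symm
  · exact smoothHalfLine_of_hasDerivAt (f := fun n y => dirichletSolution u₀ g₀ n y t)
      (fun y hy => heq y t hy ht) (fun n y hy => hF.space n y t hy ht)
      (fun n => ⟨_, hbdry n t ht⟩)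
  · intro t ht
    refine (hbdry n t ht).congr' ?_
    filter_upwards [self_mem_nhdsWithin] with x hx using (hspace n x t hx ht).symm
  -- the traces of a fixed parity form a sequence of successive derivatives
  · exact contDiffOn_of_hasDerivAt (f := fun j => g (n + 2 * j))
      (fun j t ht => hgderiv (n + 2 * j) t ht) 0
  · exact smoothHalfLine_of_hasDerivAt (f := fun n => dirichletSolution u₀ g₀ (2 * n) x)
      (fun s hs => heq x s hx hs) (hF.time_iterate hx) (fun n => ⟨_, hinit (2 * n) x hx⟩)
  · intro x hx
    refine (hinit (2 * n) x hx).congr' ?_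
    filter_upwards [self_mem_nhdsWithin] with t ht using (htime n x t hx ht).symm
  · exact contDiffOn_of_hasDerivAt (f := fun j => iteratedDeriv j u₀)
      (fun j x hx => hu₀.1.1.hasDerivAt_iteratedDeriv j hx) (2 * n)
  · obtain ⟨C, hC⟩ := dirichletSolution_decay hu₀.aestronglyMeasurable hu₀.integrableOn_pow_mul
      hg₀.1 hg hα (β := β) M N
    refine ⟨C, fun x hx t ht => ?_⟩
    rw [hspace N x t hx (hα.trans_le ht.1)]
    exact hC x hx t ht
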